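/- All algebras are associative and unital over $\mathbb C$. Let $E=E_0\oplus E_1$ be a $\mathbb Z_2$-graded algebra (not necessarily finite dimensional) and let $F=F_0\oplus F_1$ be a nonzero finite dimensional $\mathbb Z_2$-graded algebra. Call a $\mathbb Z_2$-graded algebra *graded semisimple* if, as a graded right module over itself, it is a direct sum of simple graded right modules (graded modules that are nonzero and have no graded submodules other than $0$ and themselves). Let $E\hat\otimes F$ be the twisted tensor product: the vector space $E\otimes F$ with the multiplication $$(x\otimes y)(x'\otimes y')=(-1)^{|y||x'|}\,xx'\otimes yy'$$ for homogeneous $x,x'\in E$ and $y,y'\in F$, and with the $\mathbb Z_2$-grading $(E\hat\otimes F)_k=\bigoplus_{i+j=k}E_i\otimes F_j$. Let $\operatorname{gldim}_{\mathbb Z_2}E\in\{0,1,2,\dots,\infty\}$ be the graded right global dimension of $E$, that is, the supremum over all $\mathbb Z_2$-graded right $E$-modules $M$ of the least length of a resolution of $M$ by projective objects of the category of $\mathbb Z_2$-graded right $E$-modules and degree-preserving homomorphisms (the zero module has dimension $0$). If $F$ is graded semisimple, then $$\operatorname{gldim}_{\mathbb Z_2}(E\hat\otimes F)=\operatorname{gldim}_{\mathbb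 Z_2}E .$$ In particular, $E\hat\otimes F$ is graded semisimple if and only if $E$ is graded semisimple. -/

import Mathlib

open scoped TensorProduct

universe u

noncomputable section

namespace Z2Graded

/-! ### Graded right modules -/

section Modules

variable {E : Type u} [Ring E] [Algebra ℂ E]

/-- A `ℤ/2`-graded right module over the `ℤ/2`-graded algebra `E = 𝒜 0 ⊕ 𝒜 1`. Right modules over
`E` are modules over the opposite ring, `m · a = MulOpposite.op a • m`. -/
structure GrMod (𝒜 : ZMod 2 → Submodule ℂ E) [GradedAlgebra 𝒜] : Type (u + 1) where
  /-- the underlying abelian group -/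
  carrier : Type u
  [addCommGroup : AddCommGroup carrier]
  [module : Module Eᵐᵒᵖ carrier]
  /-- the homogeneous components -/
  deg : ZMod 2 → AddSubgroup carrier
  isInternal : DirectSum.IsInternal deg
  smul_mem : ∀ (i j : ZMod 2) (m : carrier) (a : E), m ∈ deg i → a ∈ 𝒜 j →
    MulOpposite.op a • m ∈ deg (i + j)

attribute [instance] GrMod.addCommGroup GrMod.module

variable {𝒜 : ZMod 2 → Submodule ℂ E} [GradedAlgebra 𝒜]

/-- A morphism of graded right modules: an `E`-linear map preserving degrees. -/
structure GrHom (M N : GrMod 𝒜) where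
  /-- the underlying `E`-linear map -/
  toLin : M.carrier →ₗ[Eᵐᵒᵖ] N.carrier
  map_deg : ∀ (i : ZMod 2) (m : M.carrier), m ∈ M.deg i → toLin m ∈ N.deg i

/-- `P` is a projective object of the category of graded right modules: morphisms out of `P` lift
along every surjective morphism. -/
def IsGrProjective (P : GrMod 𝒜) : Prop :=
  ∀ (M N : GrMod 𝒜) (g : GrHom M N) (f : GrHom P N), Function.Surjective g.toLin →
    ∃ h : GrHom P M, g.toLin.comp h.toLin = f.toLin

/-- `M` has a graded projective resolution
`0 → P n → ⋯ → P 1 → P 0 → M → 0` of length at most `n`. -/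
def HasGrProjDimLE (M : GrMod 𝒜) (n : ℕ) : Prop :=
  ∃ (P : ℕ → GrMod 𝒜) (d : ∀ i, GrHom (P (i + 1)) (P i)) (ε : GrHom (P 0) M),
    (∀ i, IsGrProjective (P i)) ∧
    (∀ i, n < i → Subsingleton (P i).carrier) ∧
    Function.Surjective ε.toLin ∧
    Function.Exact (d 0).toLin ε.toLin ∧
    ∀ i, Function.Exact (d (i + 1)).toLin (d i).toLin

/-- The graded projective dimension: the least length of a graded projective resolution,
and `⊤` if there is no finite one. -/
def grProjDim (M : GrMod 𝒜) : ℕ∞ :=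
  ⨅ (n : ℕ) (_ : HasGrProjDimLE M n), (n : ℕ∞)

variable (𝒜) in
/-- The graded right global dimension: the supremum of the graded projective dimensions of all
graded right modules. -/
def grGlobalDim : ℕ∞ :=
  ⨆ M : GrMod 𝒜, grProjDim M

end Modules

/-! ### Graded semisimple algebras -/

section Semisimple

variable {E : Type u} [Ring E] [Algebra ℂ E] (𝒜 : ZMod 2 → Submodule ℂ E) [GradedAlgebra 𝒜]

/-- A graded right ideal `S` of `E`, simple as a graded right module: it is nonzero, and its
only graded submodules are `0` and `S`. -/
structure IsGrSimple (S : Submodule Eᵐᵒᵖ E) : Prop where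
  isHomogeneous : S.IsHomogeneous 𝒜
  ne_bot : S ≠ ⊥
  eq_bot_or_eq : ∀ T : Submodule Eᵐᵒᵖ E, T.IsHomogeneous 𝒜 → T ≤ S → T = ⊥ ∨ T = S

open Classical in
/-- `E` is graded semisimple: as a graded right module over itself, `E` is the (internal) direct
sum of a family of simple graded submodules. -/
def IsGrSemisimple : Prop :=
  ∃ 𝒮 : Set (Submodule Eᵐᵒᵖ E), (∀ S ∈ 𝒮, IsGrSimple 𝒜 S) ∧
    DirectSum.IsInternal (fun S : 𝒮 => (S : Submodule Eᵐᵒᵖ E))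

end Semisimple

/-! ### The grading on the twisted tensor product

Mathlib's `𝒜 ᵍ⊗[ℂ] ℬ` is `E ⊗ F` with the multiplication
`(x ⊗ y) (x' ⊗ y') = (-1) ^ (|y| |x'|) (x x' ⊗ y y')`. -/

section Tensor

variable {E F : Type u} [Ring E] [Algebra ℂ E] [Ring F] [Algebra ℂ F]
  (𝒜 : ZMod 2 → Submodule ℂ E) [GradedAlgebra 𝒜]
  (ℬ : ZMod 2 → Submodule ℂ F) [GradedAlgebra ℬ]

/-- The component of degree `k` of the twisted tensor product is spanned by the `a ⊗ b` with `a`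
and `b` homogeneous and `|a| + |b| = k`. -/
def tensorGrading (k : ZMod 2) : Submodule ℂ (𝒜 ᵍ⊗[ℂ] ℬ) :=
  Submodule.span ℂ {x | ∃ (i j : ZMod 2) (a : E) (b : F),
    i + j = k ∧ a ∈ 𝒜 i ∧ b ∈ ℬ j ∧ x = GradedTensorProduct.tmul ℂ a b}

theorem tmul_mem_tensorGrading {i j : ZMod 2} {a : E} {b : F} (ha : a ∈ 𝒜 i) (hb : b ∈ ℬ j) :
    (GradedTensorProduct.tmul ℂ a b : 𝒜 ᵍ⊗[ℂ] ℬ) ∈ tensorGrading 𝒜 ℬ (i + j) :=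
  Submodule.subset_span ⟨i, j, a, b, rfl, ha, hb, rfl⟩

/-- The projection of the twisted tensor product to its component of degree `k`. -/
def tensorProj (k : ZMod 2) : (𝒜 ᵍ⊗[ℂ] ℬ) →ₗ[ℂ] (𝒜 ᵍ⊗[ℂ] ℬ) :=
  ∑ i : ZMod 2, (GradedTensorProduct.of ℂ 𝒜 ℬ).toLinearMap ∘ₗ
    TensorProduct.map (GradedAlgebra.proj 𝒜 i) (GradedAlgebra.proj ℬ (k - i)) ∘ₗ
      (GradedTensorProduct.of ℂ 𝒜 ℬ).symm.toLinearMap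

theorem tensorProj_tmul (k : ZMod 2) (a : E) (b : F) :
    tensorProj 𝒜 ℬ k (GradedTensorProduct.tmul ℂ a b) =
      ∑ i : ZMod 2, GradedTensorProduct.tmul ℂ (GradedAlgebra.proj 𝒜 i a)
        (GradedAlgebra.proj ℬ (k - i) b) := by
  simp [tensorProj, LinearMap.sum_apply]

theorem tensorProj_mem (k : ZMod 2) (x : 𝒜 ᵍ⊗[ℂ] ℬ) :
    tensorProj 𝒜 ℬ k x ∈ tensorGrading 𝒜 ℬ k := by
  obtain ⟨y, rfl⟩ := (GradedTensorProduct.of ℂ 𝒜 ℬ).surjective x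
  induction y with
  | zero => simp
  | add y z hy hz => rw [map_add, map_add]; exact add_mem hy hz
  | tmul a b =>
    rw [tensorProj_tmul]
    refine sum_mem fun i _ => ?_
    have h := tmul_mem_tensorGrading 𝒜 ℬ (SetLike.coe_mem (DirectSum.decompose 𝒜 a i))
      (SetLike.coe_mem (DirectSum.decompose ℬ b (k - i)))
    rwa [add_sub_cancel] at h

theorem tensorProj_of_mem {k : ZMod 2} {x : 𝒜 ᵍ⊗[ℂ] ℬ} (hx : x ∈ tensorGrading 𝒜 ℬ k)
    (l : ZMod 2) : tensorProj 𝒜 ℬ l x = if l = k then x else 0 := by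
  induction hx using Submodule.span_induction with
  | zero => simp
  | add y z _ _ hy hz => rw [map_add, hy, hz]; split_ifs <;> simp
  | smul c y _ hy => rw [map_smul, hy]; split_ifs <;> simp
  | mem y hy =>
    obtain ⟨i, j, a, b, rfl, ha, hb, rfl⟩ := hy
    rw [tensorProj_tmul, Finset.sum_eq_single i]
    · rw [GradedAlgebra.proj_apply, GradedAlgebra.proj_apply, DirectSum.decompose_of_mem_same 𝒜 ha]
      split_ifs with h
      · subst h
        rw [add_sub_cancel_left, DirectSum.decompose_of_mem_same ℬ hb]
      · rw [DirectSum.decompose_of_mem_ne ℬ hb (fun h' => h (by rw [h', add_sub_cancel]))]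
        simp [GradedTensorProduct.tmul]
    · intro i' _ hi'
      rw [GradedAlgebra.proj_apply, DirectSum.decompose_of_mem_ne 𝒜 ha hi'.symm]
      simp [GradedTensorProduct.tmul]
    · simp

theorem sum_proj {A : Type u} [Ring A] [Algebra ℂ A] (𝒞 : ZMod 2 → Submodule ℂ A)
    [GradedAlgebra 𝒞] (a : A) : ∑ i : ZMod 2, GradedAlgebra.proj 𝒞 i a = a := by
  classical
  conv_rhs => rw [← DirectSum.sum_support_decompose 𝒞 a]
  refine (Finset.sum_subset (Finset.subset_univ _) fun i _ hi => ?_).symm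
  simpa using hi

theorem sum_tensorProj (x : 𝒜 ᵍ⊗[ℂ] ℬ) : ∑ k : ZMod 2, tensorProj 𝒜 ℬ k x = x := by
  obtain ⟨y, rfl⟩ := (GradedTensorProduct.of ℂ 𝒜 ℬ).surjective x
  induction y with
  | zero => simp
  | add y z hy hz => simp only [map_add, Finset.sum_add_distrib]; rw [hy, hz]
  | tmul a b =>
    simp only [tensorProj_tmul]
    rw [Finset.sum_comm]
    have h : ∀ i : ZMod 2, ∑ k : ZMod 2, (GradedTensorProduct.tmul ℂ (GradedAlgebra.proj 𝒜 i a)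
        (GradedAlgebra.proj ℬ (k - i) b) : 𝒜 ᵍ⊗[ℂ] ℬ) =
        GradedTensorProduct.tmul ℂ (GradedAlgebra.proj 𝒜 i a) b := by
      intro i
      refine ((Equiv.subRight i).sum_comp (fun k => (GradedTensorProduct.tmul ℂ
        (GradedAlgebra.proj 𝒜 i a) (GradedAlgebra.proj ℬ k b) : 𝒜 ᵍ⊗[ℂ] ℬ))).trans ?_
      simp only [GradedTensorProduct.tmul]
      rw [← map_sum, ← TensorProduct.tmul_sum, sum_proj]
    simp only [h]
    simp only [GradedTensorProduct.tmul]
    rw [← map_sum, ← TensorProduct.sum_tmul, sum_proj]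

/-- The twisted tensor product is again a `ℤ/2`-graded algebra. -/
instance tensorGradedAlgebra : GradedAlgebra (tensorGrading 𝒜 ℬ) where
  one_mem := by
    have h := tmul_mem_tensorGrading 𝒜 ℬ (SetLike.GradedOne.one_mem (A := 𝒜))
      (SetLike.GradedOne.one_mem (A := ℬ))
    rwa [add_zero] at h
  mul_mem := by
    intro k l x y hx hy
    induction hx using Submodule.span_induction with
    | zero => simp
    | add x x' _ _ hx hx' => rw [add_mul]; exact add_mem hx hx'
    | smul c x _ hx => rw [smul_mul_assoc]; exact Submodule.smul_mem _ c hx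
    | mem x hx =>
      induction hy using Submodule.span_induction with
      | zero => simp
      | add y y' _ _ hy hy' => rw [mul_add]; exact add_mem hy hy'
      | smul c y _ hy => rw [mul_smul_comm]; exact Submodule.smul_mem _ c hy
      | mem y hy =>
        obtain ⟨i, j, a, b, rfl, ha, hb, rfl⟩ := hx
        obtain ⟨i', j', a', b', rfl, ha', hb', rfl⟩ := hy
        have h := GradedTensorProduct.tmul_coe_mul_coe_tmul (R := ℂ) 𝒜 ℬ a ⟨b, hb⟩ ⟨a', ha'⟩ b'
        dsimp only at h
        rw [h, Units.smul_def, ← Int.cast_smul_eq_zsmul ℂ, add_add_add_comm]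
        exact Submodule.smul_mem _ _ (tmul_mem_tensorGrading 𝒜 ℬ
          (SetLike.GradedMul.mul_mem ha ha') (SetLike.GradedMul.mul_mem hb hb'))
  decompose' x := ∑ k : ZMod 2,
    DirectSum.of (fun k => tensorGrading 𝒜 ℬ k) k ⟨tensorProj 𝒜 ℬ k x, tensorProj_mem 𝒜 ℬ k x⟩
  left_inv x := by
    rw [map_sum]
    simp only [DirectSum.coeAddMonoidHom_of]
    exact sum_tensorProj 𝒜 ℬ x
  right_inv x := by
    have key : ∀ y : 𝒜 ᵍ⊗[ℂ] ℬ, ∀ l : ZMod 2, ((∑ k : ZMod 2,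
        DirectSum.of (fun k => tensorGrading 𝒜 ℬ k) k
          ⟨tensorProj 𝒜 ℬ k y, tensorProj_mem 𝒜 ℬ k y⟩) l : 𝒜 ᵍ⊗[ℂ] ℬ) =
        tensorProj 𝒜 ℬ l y := by
      intro y l
      rw [DFinsupp.finsetSum_apply, Finset.sum_eq_single l]
      · rw [DirectSum.of_eq_same]
      · intro k _ hk
        rw [DirectSum.of_eq_of_ne _ _ _ hk.symm]
      · simp
    refine DFinsupp.ext fun l => Subtype.ext ?_
    rw [key]
    induction x using DirectSum.induction_on with
    | zero => simp
    | of k y =>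
      rw [DirectSum.coeAddMonoidHom_of, tensorProj_of_mem 𝒜 ℬ y.2, DirectSum.coe_of_apply]
      simp only [eq_comm]
      split_ifs <;> rfl
    | add x y hx hy => rw [map_add, map_add, hx, hy]; rfl

end Tensor

end Z2Graded

end

/-!
Since `2` is invertible, a grading by `ℤ/2` on a module is the same thing as an additive involution
which is semilinear with respect to the grading involution `a₀ + a₁ ↦ a₀ - a₁` of the algebra
(`GrMod.ofInvolution`, `GrMod.inv`). Averaging over this involution makes the grading irrelevant for
all the notions of the theorem, which then becomes a statement about ungraded right modules:

* a graded module is graded projective iff it is projective (`isGrProjective_iff`), since linear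
  lifts can be averaged to degree-preserving ones; hence graded projective dimension is projective
  dimension, and it can be computed in the abelian category of all modules;
* every module `V` is a direct summand of a graded module, the sum of `V` and its twist by the
  involution, so that the graded global dimension is the ungraded one (`grGlobalDim_le_iff`);
* an algebra is graded semisimple iff it is semisimple (`isGrSemisimple_iff`), that is, iff its
  graded global dimension is zero (`isGrSemisimple_iff_grGlobalDim_eq_zero`).

In particular `F` is a semisimple algebra, so by Wedderburn's theorem it is a product of matrix
algebras over `ℂ` and has a separability idempotent `∑ xᵢ ⊗ yᵢ`, which may be taken even by
averaging again. For a module `P` over the twisted tensor product and an `E`-linear map `h` from `P`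
to another one, the map `n ↦ ∑ h (n xᵢ) yᵢ` is linear over the twisted tensor product: evenness is
what makes the signs cancel. So `P` is projective as soon as it is projective over `E`; the converse
holds because the twisted tensor product is projective as a right `E`-module
(`projective_twist_iff`). It follows by dimension shifting that the projective dimension of a module
over the twisted tensor product does not change when it is restricted to `E`
(`projDimLE_iff_of_projective_iff`). This bounds the global dimension of the twisted tensor product
by that of `E`. Conversely, every `E`-module `N` is a direct summand of the restriction of the
induced module `N ⊗ F` (`projDimLE_of_twist`), as `F` is nonzero.
-/

noncomputable section

namespace Z2Graded

/-! ### The grading involution -/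

theorem zmod_two_cases (i : ZMod 2) : i = 0 ∨ i = 1 := by
  revert i; decide

section Sgn

variable {E : Type u} [Ring E] [Algebra ℂ E] (𝒜 : ZMod 2 → Submodule ℂ E) [GradedAlgebra 𝒜]

theorem proj_mem (i : ZMod 2) (a : E) : GradedAlgebra.proj 𝒜 i a ∈ 𝒜 i := by
  rw [GradedAlgebra.proj_apply]; exact SetLike.coe_mem _

theorem exists_eq_add_of_grading (a : E) : ∃ b ∈ 𝒜 0, ∃ c ∈ 𝒜 1, a = b + c :=
  ⟨_, proj_mem 𝒜 0 a, _, proj_mem 𝒜 1 a, by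
    conv_lhs => rw [← sum_proj 𝒜 a]
    exact Fin.sum_univ_two _⟩

/-- The linear map underlying the grading involution. -/
def sgnLin : E →ₗ[ℂ] E := GradedAlgebra.proj 𝒜 0 - GradedAlgebra.proj 𝒜 1

theorem sgnLin_of_mem_zero {a : E} (ha : a ∈ 𝒜 0) : sgnLin 𝒜 a = a := by
  simp [sgnLin, GradedAlgebra.proj_apply, DirectSum.decompose_of_mem_same 𝒜 ha,
    DirectSum.decompose_of_mem_ne 𝒜 ha (zero_ne_one)]

theorem sgnLin_of_mem_one {a : E} (ha : a ∈ 𝒜 1) : sgnLin 𝒜 a = -a := by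
  simp [sgnLin, GradedAlgebra.proj_apply, DirectSum.decompose_of_mem_same 𝒜 ha,
    DirectSum.decompose_of_mem_ne 𝒜 ha (one_ne_zero)]

theorem mul_mem_grading {i j : ZMod 2} (k : ZMod 2) {a b : E} (ha : a ∈ 𝒜 i) (hb : b ∈ 𝒜 j)
    (h : i + j = k) : a * b ∈ 𝒜 k :=
  h ▸ SetLike.GradedMul.mul_mem ha hb

/-- The grading involution `a₀ + a₁ ↦ a₀ - a₁` of a `ℤ/2`-graded algebra. -/
def sgn : E →ₐ[ℂ] E :=
  AlgHom.ofLinearMap (sgnLin 𝒜) (sgnLin_of_mem_zero 𝒜 SetLike.GradedOne.one_mem) (by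
    intro x y
    obtain ⟨a, ha, b, hb, rfl⟩ := exists_eq_add_of_grading 𝒜 x
    obtain ⟨c, hc, d, hd, rfl⟩ := exists_eq_add_of_grading 𝒜 y
    simp only [mul_add, add_mul, map_add]
    rw [sgnLin_of_mem_zero 𝒜 (mul_mem_grading 𝒜 0 ha hc (by decide)),
      sgnLin_of_mem_one 𝒜 (mul_mem_grading 𝒜 1 hb hc (by decide)),
      sgnLin_of_mem_one 𝒜 (mul_mem_grading 𝒜 1 ha hd (by decide)),
      sgnLin_of_mem_zero 𝒜 (mul_mem_grading 𝒜 0 hb hd (by decide)),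
      sgnLin_of_mem_zero 𝒜 ha, sgnLin_of_mem_one 𝒜 hb, sgnLin_of_mem_zero 𝒜 hc,
      sgnLin_of_mem_one 𝒜 hd]
    noncomm_ring)

theorem sgn_of_mem_zero {a : E} (ha : a ∈ 𝒜 0) : sgn 𝒜 a = a := sgnLin_of_mem_zero 𝒜 ha

theorem sgn_of_mem_one {a : E} (ha : a ∈ 𝒜 1) : sgn 𝒜 a = -a := sgnLin_of_mem_one 𝒜 ha

@[simp] theorem sgn_sgn (a : E) : sgn 𝒜 (sgn 𝒜 a) = a := by
  obtain ⟨b, hb, c, hc, rfl⟩ := exists_eq_add_of_grading 𝒜 a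
  simp [sgn_of_mem_zero 𝒜 hb, sgn_of_mem_one 𝒜 hc]

/-- The grading involution on the opposite algebra. -/
def sgnOp : Eᵐᵒᵖ →+* Eᵐᵒᵖ := (sgn 𝒜).toRingHom.op

@[simp] theorem sgnOp_op (a : E) : sgnOp 𝒜 (MulOpposite.op a) = MulOpposite.op (sgn 𝒜 a) := rfl

@[simp] theorem sgnOp_sgnOp (r : Eᵐᵒᵖ) : sgnOp 𝒜 (sgnOp 𝒜 r) = r :=
  MulOpposite.unop_injective (sgn_sgn 𝒜 r.unop)

end Sgn

/-! ### Halving -/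

section Half

variable {R : Type*} [Ring R] [Algebra ℂ R] {V W : Type*} [AddCommGroup V] [Module R V]
  [AddCommGroup W] [Module R W]

variable (R V) in
/-- Multiplication by `1/2` on a module over a complex algebra. -/
def half : V →ₗ[R] V where
  toFun v := algebraMap ℂ R 2⁻¹ • v
  map_add' := smul_add _
  map_smul' r v := by simp only [smul_smul, Algebra.commutes, RingHom.id_apply]

theorem half_add_self (v : V) : half R V v + half R V v = v := by
  change algebraMap ℂ R 2⁻¹ • v + algebraMap ℂ R 2⁻¹ • v = v
  rw [← add_smul, ← map_add, show (2⁻¹ + 2⁻¹ : ℂ) = 1 by norm_num, map_one, one_smul]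

variable (R) in
theorem half_map_add (v : V) : half R V (v + v) = v := by rw [map_add, half_add_self]

variable (R) in
include R in
theorem eq_zero_of_add_self {v : V} (h : v + v = 0) : v = 0 := by
  rw [← half_map_add R v, h, map_zero]

variable (R) in
include R in
theorem eq_of_add_self {v w : V} (h : v + v = w + w) : v = w := by
  rw [← half_map_add R v, h, half_map_add R w]

theorem map_half {f : V → W} (hf : ∀ x y, f (x + y) = f x + f y) (v : V) :
    f (half R V v) = half R W (f v) := by
  refine eq_of_add_self R ?_
  rw [← hf, half_add_self, half_add_self]

end Half

/-! ### Graded modules as modules with an involution -/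

section Modules

variable {E : Type u} [Ring E] [Algebra ℂ E] {𝒜 : ZMod 2 → Submodule ℂ E} [GradedAlgebra 𝒜]

/-- The eigenspaces of an additive involution: `+1` in degree `0`, `-1` in degree `1`. -/
def eigen {V : Type*} [AddCommGroup V] (s : V →+ V) (i : ZMod 2) : AddSubgroup V :=
  if i = 0 then (s - AddMonoidHom.id V).ker else (s + AddMonoidHom.id V).ker

theorem mem_eigen_zero {V : Type*} [AddCommGroup V] {s : V →+ V} {v : V} :
    v ∈ eigen s 0 ↔ s v = v := by
  simp [eigen, AddMonoidHom.mem_ker, sub_eq_zero]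

theorem mem_eigen_one {V : Type*} [AddCommGroup V] {s : V →+ V} {v : V} :
    v ∈ eigen s 1 ↔ s v = -v := by
  simp [eigen, AddMonoidHom.mem_ker, add_eq_zero_iff_eq_neg]

theorem coeAddMonoidHom_apply_zmod_two {V : Type*} [AddCommGroup V]
    (deg : ZMod 2 → AddSubgroup V) (x : DirectSum (ZMod 2) (fun i => deg i)) :
    DirectSum.coeAddMonoidHom deg x = (x 0 : V) + (x 1 : V) := by
  induction x using DirectSum.induction_on with
  | zero => simp
  | add x y hx hy =>
    simp only [map_add, hx, hy, DirectSum.add_apply, AddSubgroup.coe_add]; abel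
  | of i x =>
    rw [DirectSum.coeAddMonoidHom_of]
    rcases zmod_two_cases i with rfl | rfl
    · rw [DirectSum.of_eq_same, DirectSum.of_eq_of_ne _ _ _ one_ne_zero]; simp
    · rw [DirectSum.of_eq_same, DirectSum.of_eq_of_ne _ _ _ zero_ne_one]; simp

theorem isInternal_eigen (R : Type*) [Ring R] [Algebra ℂ R] {V : Type*} [AddCommGroup V]
    [Module R V] (s : V →+ V) (hs : ∀ v, s (s v) = v) : DirectSum.IsInternal (eigen s) := by
  constructor
  · rw [injective_iff_map_eq_zero]
    intro x hx
    rw [coeAddMonoidHom_apply_zmod_two] at hx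
    have h0 := mem_eigen_zero.1 (x 0).2
    have h1 := mem_eigen_one.1 (x 1).2
    have hx' := congrArg s hx
    rw [map_add, h0, h1, map_zero, ← sub_eq_add_neg, sub_eq_zero] at hx'
    rw [← hx'] at hx
    have hz := eq_zero_of_add_self R hx
    refine DFinsupp.ext fun i => Subtype.ext ?_
    rcases zmod_two_cases i with rfl | rfl
    · exact hz
    · exact hx' ▸ hz
  · intro v
    have hh (w : V) : s (half R V w) = half R V (s w) := map_half (map_add s) w
    refine ⟨DirectSum.of (fun i => eigen s i) 0 ⟨half R V (v + s v), mem_eigen_zero.2 ?_⟩ +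
      DirectSum.of (fun i => eigen s i) 1 ⟨half R V (v - s v), mem_eigen_one.2 ?_⟩, ?_⟩
    · rw [hh, map_add, hs, add_comm]
    · rw [hh, map_sub, hs, ← map_neg, neg_sub]
    · rw [map_add, DirectSum.coeAddMonoidHom_of, DirectSum.coeAddMonoidHom_of, ← map_add]
      rw [add_add_sub_cancel, half_map_add]

variable (𝒜) in
/-- The graded module given by a module `V` and an additive involution `s` of `V` which is
semilinear with respect to the grading involution of the algebra: `V` is graded by the eigenspaces
of `s`. -/
abbrev GrMod.ofInvolution (V : Type u) [AddCommGroup V] [Module Eᵐᵒᵖ V] (s : V →+ V)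
    (hs : ∀ v, s (s v) = v) (hsm : ∀ (r : Eᵐᵒᵖ) (v : V), s (r • v) = sgnOp 𝒜 r • s v) :
    GrMod 𝒜 where
  carrier := V
  deg := eigen s
  isInternal := isInternal_eigen Eᵐᵒᵖ s hs
  smul_mem i j v a hv ha := by
    rcases zmod_two_cases i with rfl | rfl <;> rcases zmod_two_cases j with rfl | rfl
    · rw [mem_eigen_zero] at hv
      rw [add_zero, mem_eigen_zero, hsm, sgnOp_op, sgn_of_mem_zero 𝒜 ha, hv]
    · rw [mem_eigen_zero] at hv
      rw [zero_add, mem_eigen_one, hsm, sgnOp_op, sgn_of_mem_one 𝒜 ha, hv, MulOpposite.op_neg,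
        neg_smul]
    · rw [mem_eigen_one] at hv
      rw [add_zero, mem_eigen_one, hsm, sgnOp_op, sgn_of_mem_zero 𝒜 ha, hv, smul_neg]
    · rw [mem_eigen_one] at hv
      rw [show (1 + 1 : ZMod 2) = 0 by decide, mem_eigen_zero, hsm, sgnOp_op,
        sgn_of_mem_one 𝒜 ha, hv, MulOpposite.op_neg, smul_neg, neg_smul, neg_neg]

namespace GrMod

variable (M : GrMod 𝒜)

theorem exists_eq_add (m : M.carrier) : ∃ x ∈ M.deg 0, ∃ y ∈ M.deg 1, m = x + y := by
  obtain ⟨z, rfl⟩ := M.isInternal.2 m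
  exact ⟨_, (z 0).2, _, (z 1).2, coeAddMonoidHom_apply_zmod_two _ _⟩

/-- The grading involution `m₀ + m₁ ↦ m₀ - m₁` of a graded module. -/
def inv : M.carrier →+ M.carrier :=
  (DirectSum.toAddMonoid fun i : ZMod 2 =>
    if i = 0 then (M.deg i).subtype else -(M.deg i).subtype).comp
    (AddEquiv.ofBijective _ M.isInternal).symm.toAddMonoidHom

variable {M}

theorem inv_of_mem {i : ZMod 2} {m : M.carrier} (hm : m ∈ M.deg i) :
    M.inv m = if i = 0 then m else -m := by
  have h : (AddEquiv.ofBijective _ M.isInternal).symm m =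
      DirectSum.of (fun i => M.deg i) i ⟨m, hm⟩ := by
    rw [AddEquiv.symm_apply_eq]
    exact (DirectSum.coeAddMonoidHom_of M.deg i ⟨m, hm⟩).symm
  change DirectSum.toAddMonoid _ ((AddEquiv.ofBijective _ M.isInternal).symm m) = _
  rw [h, DirectSum.toAddMonoid_of]
  split_ifs <;> rfl

theorem inv_of_mem_zero {m : M.carrier} (hm : m ∈ M.deg 0) : M.inv m = m := by
  rw [inv_of_mem hm, if_pos rfl]

theorem inv_of_mem_one {m : M.carrier} (hm : m ∈ M.deg 1) : M.inv m = -m := by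
  rw [inv_of_mem hm, if_neg one_ne_zero]

@[simp] theorem inv_inv (m : M.carrier) : M.inv (M.inv m) = m := by
  obtain ⟨x, hx, y, hy, rfl⟩ := M.exists_eq_add m
  simp [inv_of_mem_zero hx, inv_of_mem_one hy]

theorem mem_deg_zero {m : M.carrier} : m ∈ M.deg 0 ↔ M.inv m = m := by
  refine ⟨inv_of_mem_zero, fun h => ?_⟩
  obtain ⟨x, hx, y, hy, rfl⟩ := M.exists_eq_add m
  rw [map_add, inv_of_mem_zero hx, inv_of_mem_one hy, add_right_inj, neg_eq_iff_add_eq_zero] at h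
  rwa [eq_zero_of_add_self Eᵐᵒᵖ h, add_zero]

theorem mem_deg_one {m : M.carrier} : m ∈ M.deg 1 ↔ M.inv m = -m := by
  refine ⟨inv_of_mem_one, fun h => ?_⟩
  obtain ⟨x, hx, y, hy, rfl⟩ := M.exists_eq_add m
  rw [map_add, inv_of_mem_zero hx, inv_of_mem_one hy, neg_add, add_left_inj,
    eq_neg_iff_add_eq_zero] at h
  rwa [eq_zero_of_add_self Eᵐᵒᵖ h, zero_add]

theorem inv_smul (r : Eᵐᵒᵖ) (m : M.carrier) : M.inv (r • m) = sgnOp 𝒜 r • M.inv m := by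
  obtain ⟨x, hx, y, hy, rfl⟩ := M.exists_eq_add m
  obtain ⟨a, rfl⟩ := MulOpposite.op_surjective r
  obtain ⟨b, hb, c, hc, rfl⟩ := exists_eq_add_of_grading 𝒜 a
  have h00 := inv_of_mem (M.smul_mem 0 0 x b hx hb)
  have h01 := inv_of_mem (M.smul_mem 0 1 x c hx hc)
  have h10 := inv_of_mem (M.smul_mem 1 0 y b hy hb)
  have h11 := inv_of_mem (M.smul_mem 1 1 y c hy hc)
  rw [if_pos (by decide)] at h00 h11
  rw [if_neg (by decide)] at h01 h10
  simp only [sgnOp_op, map_add, MulOpposite.op_add, add_smul, smul_add, h00, h01, h10, h11,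
    inv_of_mem_zero hx, inv_of_mem_one hy, sgn_of_mem_zero 𝒜 hb, sgn_of_mem_one 𝒜 hc,
    MulOpposite.op_neg, neg_smul, smul_neg, neg_add, neg_neg]

@[simp] theorem inv_ofInvolution (V : Type u) [AddCommGroup V] [Module Eᵐᵒᵖ V] (s : V →+ V)
    (hs : ∀ v, s (s v) = v) (hsm : ∀ (r : Eᵐᵒᵖ) (v : V), s (r • v) = sgnOp 𝒜 r • s v) (v : V) :
    (ofInvolution 𝒜 V s hs hsm).inv v = s v := by
  have key (x y : V) (hx : s x = x) (hy : s y = -y) :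
      (ofInvolution 𝒜 V s hs hsm).inv (x + y) = s (x + y) := by
    have h0 : (ofInvolution 𝒜 V s hs hsm).inv x = x := inv_of_mem_zero (mem_eigen_zero.2 hx)
    have h1 : (ofInvolution 𝒜 V s hs hsm).inv y = -y := inv_of_mem_one (mem_eigen_one.2 hy)
    exact (map_add _ x y).trans ((congrArg₂ (· + ·) h0 h1).trans
      ((map_add s x y).trans (congrArg₂ (· + ·) hx hy)).symm)
  obtain ⟨x, hx, y, hy, h⟩ := (ofInvolution 𝒜 V s hs hsm).exists_eq_add v
  rw [h]
  exact key x y (mem_eigen_zero.1 hx) (mem_eigen_one.1 hy)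

end GrMod

theorem GrHom.inv_comm {M N : GrMod 𝒜} (f : GrHom M N) (m : M.carrier) :
    f.toLin (M.inv m) = N.inv (f.toLin m) := by
  obtain ⟨x, hx, y, hy, rfl⟩ := M.exists_eq_add m
  simp only [map_add, GrMod.inv_of_mem_zero hx, GrMod.inv_of_mem_one hy,
    GrMod.inv_of_mem_zero (f.map_deg _ _ hx), GrMod.inv_of_mem_one (f.map_deg _ _ hy), map_neg]

/-- A linear map commuting with the grading involutions is a morphism of graded modules. -/
def GrHom.ofComm {M N : GrMod 𝒜} (f : M.carrier →ₗ[Eᵐᵒᵖ] N.carrier)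
    (hf : ∀ m, f (M.inv m) = N.inv (f m)) : GrHom M N where
  toLin := f
  map_deg i m hm := by
    rcases zmod_two_cases i with rfl | rfl
    · rw [GrMod.mem_deg_zero] at hm ⊢; rw [← hf, hm]
    · rw [GrMod.mem_deg_one] at hm ⊢; rw [← hf, hm, map_neg]

/-- A linear map commuting with the involutions, out of the graded module given by an
involution. -/
def GrHom.ofInvolution {V : Type u} [AddCommGroup V] [Module Eᵐᵒᵖ V] {s : V →+ V}
    {hs : ∀ v, s (s v) = v} {hsm : ∀ (r : Eᵐᵒᵖ) (v : V), s (r • v) = sgnOp 𝒜 r • s v}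
    {N : GrMod 𝒜} (f : V →ₗ[Eᵐᵒᵖ] N.carrier) (hf : ∀ v, f (s v) = N.inv (f v)) :
    GrHom (GrMod.ofInvolution 𝒜 V s hs hsm) N :=
  GrHom.ofComm (M := GrMod.ofInvolution 𝒜 V s hs hsm) f
    (fun v => (congrArg f (GrMod.inv_ofInvolution V s hs hsm v)).trans (hf v))

end Modules

/-! ### Graded projectivity is projectivity -/

section Projective

variable {E : Type u} [Ring E] [Algebra ℂ E] {𝒜 : ZMod 2 → Submodule ℂ E} [GradedAlgebra 𝒜]

/-- The degree-preserving part of a linear map `h` between graded modules, that is, the average of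
`h` and of its conjugate by the grading involutions. -/
def GrHom.average {M N : GrMod 𝒜} (h : M.carrier →ₗ[Eᵐᵒᵖ] N.carrier) : GrHom M N :=
  GrHom.ofComm
    (half Eᵐᵒᵖ N.carrier ∘ₗ
      { toFun := fun m => h m + N.inv (h (M.inv m))
        map_add' := fun x y => by simp only [map_add]; abel
        map_smul' := fun r x => by
          simp only [map_smul, GrMod.inv_smul, sgnOp_sgnOp, smul_add, RingHom.id_apply] })
    (fun m => by
      change half Eᵐᵒᵖ _ (h (M.inv m) + N.inv (h (M.inv (M.inv m)))) =
        N.inv (half Eᵐᵒᵖ _ (h m + N.inv (h (M.inv m))))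
      rw [map_half (map_add N.inv), map_add N.inv, GrMod.inv_inv, GrMod.inv_inv, add_comm])

theorem GrHom.average_apply {M N : GrMod 𝒜} (h : M.carrier →ₗ[Eᵐᵒᵖ] N.carrier) (m : M.carrier) :
    (GrHom.average h).toLin m = half Eᵐᵒᵖ N.carrier (h m + N.inv (h (M.inv m))) := rfl

namespace GrMod

variable (M : GrMod 𝒜)

/-- The involution of the free module on the elements of `M` which permutes the basis as the
involution of `M` does, and acts on the coefficients as the involution of the algebra does. -/
def freeInv : (M.carrier →₀ Eᵐᵒᵖ) →+ (M.carrier →₀ Eᵐᵒᵖ) :=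
  (Finsupp.mapDomain.addMonoidHom M.inv).comp
    (Finsupp.mapRange.addMonoidHom (sgnOp 𝒜).toAddMonoidHom)

theorem freeInv_single (m : M.carrier) (r : Eᵐᵒᵖ) :
    M.freeInv (Finsupp.single m r) = Finsupp.single (M.inv m) (sgnOp 𝒜 r) := by
  simp [freeInv, Finsupp.mapDomain_single]

/-- The free graded module on the elements of `M`. -/
abbrev free : GrMod 𝒜 :=
  ofInvolution 𝒜 (M.carrier →₀ Eᵐᵒᵖ) M.freeInv
    (fun v => by
      induction v using Finsupp.induction_linear with
      | zero => simp
      | add v w hv hw => rw [map_add, map_add, hv, hw]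
      | single m r => rw [freeInv_single, freeInv_single, inv_inv, sgnOp_sgnOp])
    (fun r v => by
      induction v using Finsupp.induction_linear with
      | zero => simp
      | add v w hv hw => rw [smul_add, map_add, map_add, hv, hw, smul_add]
      | single m t => rw [Finsupp.smul_single, freeInv_single, freeInv_single,
          Finsupp.smul_single, smul_eq_mul, smul_eq_mul, map_mul])

/-- The canonical morphism from the free graded module on `M` to `M`. -/
def freeHom : GrHom M.free M :=
  GrHom.ofInvolution (Finsupp.linearCombination Eᵐᵒᵖ (id : M.carrier → M.carrier))
    (fun v => by
      induction v using Finsupp.induction_linear with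
      | zero => simp
      | add v w hv hw => rw [map_add, map_add, hv, hw, map_add, map_add]
      | single m r =>
        rw [freeInv_single, Finsupp.linearCombination_single, Finsupp.linearCombination_single,
          inv_smul]
        rfl)

theorem freeHom_surjective : Function.Surjective M.freeHom.toLin :=
  Finsupp.linearCombination_id_surjective Eᵐᵒᵖ M.carrier

/-- The kernel of a morphism of graded modules. -/
abbrev ker {M N : GrMod 𝒜} (f : GrHom M N) : GrMod 𝒜 :=
  ofInvolution 𝒜 (LinearMap.ker f.toLin)
    { toFun := fun m => ⟨M.inv m, by
        rw [LinearMap.mem_ker, f.inv_comm, LinearMap.mem_ker.1 m.2, map_zero]⟩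
      map_zero' := Subtype.ext (map_zero _)
      map_add' := fun x y => Subtype.ext (map_add _ _ _) }
    (fun v => Subtype.ext (inv_inv _)) (fun r v => Subtype.ext (inv_smul r _))

/-- The inclusion of the kernel. -/
def kerHom {M N : GrMod 𝒜} (f : GrHom M N) : GrHom (ker f) M :=
  GrHom.ofInvolution (LinearMap.ker f.toLin).subtype (fun _ => rfl)

theorem kerHom_injective {M N : GrMod 𝒜} (f : GrHom M N) :
    Function.Injective (kerHom f).toLin := Subtype.val_injective

theorem exact_kerHom {M N : GrMod 𝒜} (f : GrHom M N) :
    Function.Exact (kerHom f).toLin f.toLin :=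
  f.toLin.exact_subtype_ker_map

/-- The zero graded module. -/
abbrev zero : GrMod 𝒜 := ofInvolution 𝒜 PUnit 0 (fun _ => rfl) (fun _ _ => rfl)

instance : Subsingleton (zero : GrMod 𝒜).carrier := inferInstanceAs (Subsingleton PUnit)

end GrMod

/-- Projectivity is being a direct summand of the free graded cover, which is projective; conversely,
a linear lift of a morphism can be averaged to a degree-preserving one. -/
theorem isGrProjective_iff {P : GrMod 𝒜} :
    IsGrProjective P ↔ Module.Projective Eᵐᵒᵖ P.carrier := by
  constructor
  · intro hP
    obtain ⟨h, hh⟩ := hP P.free P P.freeHom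
      (GrHom.ofComm LinearMap.id fun _ => rfl) P.freeHom_surjective
    exact Module.Projective.of_split h.toLin P.freeHom.toLin hh
  · intro hP M N g f hg
    obtain ⟨h, hh⟩ := Module.projective_lifting_property g.toLin f.toLin hg
    refine ⟨GrHom.average h, LinearMap.ext fun m => ?_⟩
    have hg' (x : P.carrier) : g.toLin (h x) = f.toLin x := LinearMap.congr_fun hh x
    rw [LinearMap.comp_apply, GrHom.average_apply, map_half (map_add g.toLin), map_add,
      g.inv_comm, hg', hg', ← f.inv_comm, GrMod.inv_inv, half_map_add]

end Projective

/-! ### Every module is a direct summand of a graded module -/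

section Doubled

variable {E : Type u} [Ring E] [Algebra ℂ E] (𝒜 : ZMod 2 → Submodule ℂ E) [GradedAlgebra 𝒜]

/-- The module `V` with the action twisted by the grading involution of the algebra. -/
@[nolint unusedArguments]
def Twisted (_𝒜 : ZMod 2 → Submodule ℂ E) (V : Type u) : Type u := V

variable (V : Type u) [AddCommGroup V] [Module Eᵐᵒᵖ V]

instance : AddCommGroup (Twisted 𝒜 V) := inferInstanceAs (AddCommGroup V)

instance : Module Eᵐᵒᵖ (Twisted 𝒜 V) :=
  Module.compHom V (sgnOp 𝒜)

/-- The direct sum of `V` and its twist, graded by the involution exchanging the two summands. -/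
abbrev GrMod.doubled : GrMod 𝒜 :=
  GrMod.ofInvolution 𝒜 (V × Twisted 𝒜 V)
    { toFun := fun x => ((x.2 : V), (x.1 : V))
      map_zero' := rfl
      map_add' := fun _ _ => rfl }
    (fun _ => rfl)
    (fun r x => Prod.ext rfl (congrArg (· • x.1) (sgnOp_sgnOp 𝒜 r)).symm)

end Doubled

/-! ### Projective dimension of modules -/

section ProjDim

open CategoryTheory

variable (R : Type u) [Ring R] (V : Type u) [AddCommGroup V] [Module R V]

/-- The module `V` has projective dimension at most `n`. -/
def ProjDimLE (n : ℕ) : Prop := HasProjectiveDimensionLE (ModuleCat.of R V) n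

variable {R V}

theorem projDimLE_zero : ProjDimLE R V 0 ↔ Module.Projective R V :=
  (projective_iff_hasProjectiveDimensionLE_zero _).symm.trans (IsProjective.iff_projective V).symm

/-- Dimension shifting along a short exact sequence `0 → K → P → V → 0` with `P` projective. -/
theorem projDimLE_succ {K P : Type u} [AddCommGroup K] [Module R K] [AddCommGroup P] [Module R P]
    [Module.Projective R P] {f : K →ₗ[R] P} {g : P →ₗ[R] V} (hf : Function.Injective f)
    (hg : Function.Surjective g) (hfg : Function.Exact f g) (n : ℕ) :
    ProjDimLE R V (n + 1) ↔ ProjDimLE R K n := by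
  let S : ShortComplex (ModuleCat.{u} R) :=
    ShortComplex.mk (ModuleCat.ofHom f) (ModuleCat.ofHom g)
      (by ext x; exact hfg.apply_apply_eq_zero x)
  have hS : S.ShortExact :=
    { exact := (ShortComplex.ShortExact.moduleCat_exact_iff_function_exact S).2 hfg
      mono_f := (ModuleCat.mono_iff_injective _).2 hf
      epi_g := (ModuleCat.epi_iff_surjective _).2 hg }
  exact hS.hasProjectiveDimensionLT_X₃_iff n ((IsProjective.iff_projective P).1 ‹_›)

theorem ProjDimLE.of_retract {W : Type u} [AddCommGroup W] [Module R W] {n : ℕ}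
    (h : ProjDimLE R W n) (i : V →ₗ[R] W) (r : W →ₗ[R] V) (hri : ∀ v, r (i v) = v) :
    ProjDimLE R V n :=
  have : HasProjectiveDimensionLT (ModuleCat.of R W) (n + 1) := h
  Retract.hasProjectiveDimensionLT (Y := ModuleCat.of R W)
    { i := ModuleCat.ofHom i
      r := ModuleCat.ofHom r
      retract := by ext v; exact hri v } (n + 1)

end ProjDim

/-! ### Graded projective dimension is projective dimension -/

section GrProjDim

variable {E : Type u} [Ring E] [Algebra ℂ E] {𝒜 : ZMod 2 → Submodule ℂ E} [GradedAlgebra 𝒜]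

theorem isGrProjective_of_subsingleton {P : GrMod 𝒜} [Subsingleton P.carrier] :
    IsGrProjective P :=
  isGrProjective_iff.2 inferInstance

/-- The corestriction of a morphism to the kernel of another one. -/
def GrHom.liftKer {L M N : GrMod 𝒜} (g : GrHom M N) (f : GrHom L M)
    (hfg : ∀ x, g.toLin (f.toLin x) = 0) : GrHom L (GrMod.ker g) :=
  GrHom.ofComm (N := GrMod.ker g) (f.toLin.codRestrict _ fun x => LinearMap.mem_ker.2 (hfg x))
    (fun m => (Subtype.ext (f.inv_comm m)).trans (GrMod.inv_ofInvolution _ _ _ _ _).symm)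

/-- A graded resolution computes the projective dimension: the kernel of the augmentation is resolved
by the remaining terms. -/
theorem HasGrProjDimLE.projDimLE {M : GrMod 𝒜} {n : ℕ} (h : HasGrProjDimLE M n) :
    ProjDimLE Eᵐᵒᵖ M.carrier n := by
  induction n generalizing M with
  | zero =>
    obtain ⟨P, d, ε, hP, hP0, hε, h0, -⟩ := h
    have := hP0 1 zero_lt_one
    have hinj : Function.Injective ε.toLin := by
      rw [injective_iff_map_eq_zero]
      intro x hx
      obtain ⟨y, rfl⟩ := (h0 x).1 hx
      rw [Subsingleton.elim y 0, map_zero]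
    have := isGrProjective_iff.1 (hP 0)
    exact projDimLE_zero.2 (Module.Projective.of_equiv (LinearEquiv.ofBijective _ ⟨hinj, hε⟩))
  | succ n ih =>
    obtain ⟨P, d, ε, hP, hP0, hε, h0, hd⟩ := h
    have := isGrProjective_iff.1 (hP 0)
    refine (projDimLE_succ (GrMod.kerHom_injective ε) hε (GrMod.exact_kerHom ε) n).2 (ih
      ⟨fun i => P (i + 1), fun i => d (i + 1), ε.liftKer (d 0) h0.apply_apply_eq_zero,
        fun i => hP _, fun i hi => hP0 _ (Nat.succ_lt_succ hi), ?_, fun x => ?_, fun i => hd _⟩)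
    · rintro ⟨x, hx⟩
      obtain ⟨y, rfl⟩ := (h0 x).1 hx
      exact ⟨y, rfl⟩
    · exact Subtype.ext_iff.trans (hd 0 x)

/-- A resolution of the kernel of the canonical free graded cover is spliced with that cover. -/
theorem ProjDimLE.hasGrProjDimLE {M : GrMod 𝒜} {n : ℕ} (h : ProjDimLE Eᵐᵒᵖ M.carrier n) :
    HasGrProjDimLE M n := by
  induction n generalizing M with
  | zero =>
    refine ⟨fun i => match i with
      | 0 => M
      | _ + 1 => GrMod.zero, fun i => match i with
      | 0 => GrHom.ofComm 0 fun _ => (map_zero _).symm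
      | _ + 1 => GrHom.ofComm 0 fun _ => (map_zero _).symm, GrHom.ofComm LinearMap.id fun _ => rfl, ?_, ?_,
      fun x => ⟨x, rfl⟩, ?_, ?_⟩
    · rintro (_ | i)
      · exact isGrProjective_iff.2 (projDimLE_zero.1 h)
      · exact isGrProjective_of_subsingleton
    · rintro (_ | i) hi
      · exact absurd hi (lt_irrefl 0)
      · exact inferInstanceAs (Subsingleton PUnit)
    · exact fun x => ⟨fun hx => ⟨0, hx.symm⟩, fun ⟨y, hy⟩ => hy.symm⟩
    · exact fun i x => ⟨fun _ => ⟨0, Subsingleton.elim (α := PUnit) _ _⟩, fun _ => by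
        cases i <;> rfl⟩
  | succ n ih =>
    obtain ⟨P, d, ε, hP, hP0, hε, h0, hd⟩ := ih ((projDimLE_succ
      (GrMod.kerHom_injective M.freeHom) M.freeHom_surjective (GrMod.exact_kerHom _) n).1 h)
    refine ⟨fun i => match i with
      | 0 => M.free
      | i + 1 => P i, fun i => match i with
      | 0 => GrHom.ofComm ((GrMod.kerHom M.freeHom).toLin ∘ₗ ε.toLin) fun x => by
        rw [LinearMap.comp_apply, LinearMap.comp_apply, ε.inv_comm, GrHom.inv_comm]
      | i + 1 => d i, M.freeHom, ?_, ?_, M.freeHom_surjective, ?_, ?_⟩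
    · rintro (_ | i)
      · exact isGrProjective_iff.2 inferInstance
      · exact hP i
    · rintro (_ | i) hi
      · exact absurd hi (Nat.not_lt_zero _)
      · exact hP0 i (Nat.lt_of_succ_lt_succ hi)
    · intro x
      refine (GrMod.exact_kerHom M.freeHom x).trans ⟨?_, ?_⟩
      · rintro ⟨y, rfl⟩
        obtain ⟨z, rfl⟩ := hε y
        exact ⟨z, rfl⟩
      · rintro ⟨z, rfl⟩
        exact ⟨ε.toLin z, rfl⟩
    · rintro (_ | i)
      · intro x
        exact (map_eq_zero_iff _ (GrMod.kerHom_injective M.freeHom)).trans (h0 x)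
      · exact hd i

theorem grProjDim_le_iff {M : GrMod 𝒜} {n : ℕ} :
    grProjDim M ≤ n ↔ ProjDimLE Eᵐᵒᵖ M.carrier n := by
  constructor
  · intro h
    have hlt : grProjDim M < (n + 1 : ℕ) := lt_of_le_of_lt h (by exact_mod_cast Nat.lt_succ_self n)
    obtain ⟨m, hm⟩ := iInf_lt_iff.1 hlt
    obtain ⟨hM, hm⟩ := iInf_lt_iff.1 hm
    have hmn : m ≤ n := Nat.lt_succ_iff.1 (by exact_mod_cast hm)
    have : CategoryTheory.HasProjectiveDimensionLT (ModuleCat.of Eᵐᵒᵖ M.carrier) (m + 1) :=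
      hM.projDimLE
    exact CategoryTheory.hasProjectiveDimensionLT_of_ge _ (m + 1) (n + 1) (Nat.succ_le_succ hmn)
  · intro h
    exact iInf₂_le n h.hasGrProjDimLE

/-- The graded global dimension is the global dimension of the ungraded algebra, since every module
is a direct summand of a graded one. -/
theorem grGlobalDim_le_iff {n : ℕ} :
    grGlobalDim 𝒜 ≤ n ↔
      ∀ (V : Type u) [AddCommGroup V] [Module Eᵐᵒᵖ V], ProjDimLE Eᵐᵒᵖ V n := by
  constructor
  · intro h V _ _
    have hV := grProjDim_le_iff.1 ((le_iSup grProjDim (GrMod.doubled 𝒜 V)).trans h)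
    exact hV.of_retract (LinearMap.inl Eᵐᵒᵖ V (Twisted 𝒜 V)) (LinearMap.fst Eᵐᵒᵖ V (Twisted 𝒜 V))
      fun _ => rfl
  · exact fun h => iSup_le fun M => grProjDim_le_iff.2 (h M.carrier)

end GrProjDim

/-! ### Graded semisimplicity is semisimplicity -/

section Semisimple

variable {E : Type u} [Ring E] [Algebra ℂ E] (𝒜 : ZMod 2 → Submodule ℂ E) [GradedAlgebra 𝒜]

/-- The grading involution as a semilinear map of the right regular module. -/
def sgnSemilinear : E →ₛₗ[sgnOp 𝒜] E where
  toFun := sgn 𝒜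
  map_add' := map_add _
  map_smul' r x := map_mul (sgn 𝒜) x r.unop

theorem sgnSemilinear_apply (x : E) : sgnSemilinear 𝒜 x = sgn 𝒜 x := rfl

/-- A right ideal is graded iff it is stable under the grading involution. -/
theorem isHomogeneous_iff {S : Submodule Eᵐᵒᵖ E} :
    S.IsHomogeneous 𝒜 ↔ S ≤ S.comap (sgnSemilinear 𝒜) := by
  have hsmul (c : ℂ) {x : E} (hx : x ∈ S) : c • x ∈ S := by
    rw [← mul_one x, ← mul_smul_comm]
    exact S.smul_mem (MulOpposite.op (c • (1 : E))) hx
  constructor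
  · intro h x hx
    exact sub_mem (h 0 hx) (h 1 hx)
  · intro h i x hx
    have hx' : sgn 𝒜 x ∈ S := h hx
    obtain ⟨a, ha, b, hb, rfl⟩ := exists_eq_add_of_grading 𝒜 x
    have hadd := hsmul 2⁻¹ (add_mem hx hx')
    have hsub := hsmul 2⁻¹ (sub_mem hx hx')
    rw [map_add, sgn_of_mem_zero 𝒜 ha, sgn_of_mem_one 𝒜 hb] at hadd hsub
    rw [show (2⁻¹ : ℂ) • (a + b + (a + -b)) = a by module] at hadd
    rw [show (2⁻¹ : ℂ) • (a + b - (a + -b)) = b by module] at hsub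
    rcases zmod_two_cases i with rfl | rfl
    · rwa [DirectSum.decompose_add, DirectSum.add_apply, Submodule.coe_add,
        DirectSum.decompose_of_mem_same 𝒜 ha, DirectSum.decompose_of_mem_ne 𝒜 hb one_ne_zero,
        add_zero]
    · rwa [DirectSum.decompose_add, DirectSum.add_apply, Submodule.coe_add,
        DirectSum.decompose_of_mem_same 𝒜 hb, DirectSum.decompose_of_mem_ne 𝒜 ha zero_ne_one,
        zero_add]

variable {𝒜}

theorem isSemisimpleModule_prod {R M N : Type*} [Ring R] [AddCommGroup M] [Module R M]
    [AddCommGroup N] [Module R N] [IsSemisimpleModule R M] [IsSemisimpleModule R N] :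
    IsSemisimpleModule R (M × N) := by
  have h := IsSemisimpleModule.sup (IsSemisimpleModule.range (LinearMap.inl R M N))
    (IsSemisimpleModule.range (LinearMap.inr R M N))
  rw [LinearMap.sup_range_inl_inr] at h
  exact IsSemisimpleModule.congr Submodule.topEquiv.symm

/-- A simple graded submodule `S` is generated by one homogeneous element, so it has a maximal
submodule `N`. As `N` and its image under the grading involution intersect in a graded submodule,
they intersect trivially, and `S` embeds in the direct sum of the two simple quotients. -/
theorem IsGrSimple.isSemisimpleModule {S : Submodule Eᵐᵒᵖ E} (hS : IsGrSimple 𝒜 S) :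
    IsSemisimpleModule Eᵐᵒᵖ S := by
  obtain ⟨x, hx, hx0⟩ := S.ne_bot_iff.1 hS.ne_bot
  obtain ⟨y, hy, hy0, hys⟩ : ∃ y ∈ S, y ≠ 0 ∧ (sgn 𝒜 y = y ∨ sgn 𝒜 y = -y) := by
    by_cases h0 : GradedAlgebra.proj 𝒜 0 x = 0
    · refine ⟨_, hS.isHomogeneous 1 hx, fun h1 => hx0 ?_, Or.inr (sgn_of_mem_one 𝒜 ?_)⟩
      · rw [← sum_proj 𝒜 x]
        exact (Fin.sum_univ_two _).trans ((congrArg₂ (· + ·) h0 h1).trans (add_zero _))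
      · exact SetLike.coe_mem _
    · exact ⟨_, hS.isHomogeneous 0 hx, h0, Or.inl (sgn_of_mem_zero 𝒜 (SetLike.coe_mem _))⟩
  have hspan : Submodule.span Eᵐᵒᵖ {y} = S := by
    refine (hS.eq_bot_or_eq _ ((isHomogeneous_iff 𝒜).2 ?_)
      ((Submodule.span_singleton_le_iff_mem _ _).2 hy)).resolve_left
      (by rwa [Submodule.span_singleton_eq_bot])
    rw [Submodule.span_singleton_le_iff_mem, Submodule.mem_comap, sgnSemilinear_apply]
    rcases hys with h | h <;> rw [h]
    · exact Submodule.mem_span_singleton_self y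
    · exact neg_mem (Submodule.mem_span_singleton_self y)
  have : Module.Finite Eᵐᵒᵖ S := by
    rw [← hspan]; infer_instance
  have : Nontrivial S := Submodule.nontrivial_iff_ne_bot.2 hS.ne_bot
  obtain ⟨N, hN⟩ := IsCoatomic.exists_coatom (Submodule Eᵐᵒᵖ S)
  have hsgn {z : E} (hz : z ∈ S) : sgn 𝒜 z ∈ S := (isHomogeneous_iff 𝒜).1 hS.isHomogeneous hz
  let σ : S →+ S :=
    { toFun := fun z => ⟨sgn 𝒜 z, hsgn z.2⟩
      map_zero' := Subtype.ext (map_zero _)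
      map_add' := fun _ _ => Subtype.ext (map_add _ _ _) }
  have hσσ (z : S) : σ (σ z) = z := Subtype.ext (sgn_sgn 𝒜 _)
  have hσsmul (r : Eᵐᵒᵖ) (z : S) : σ (r • z) = sgnOp 𝒜 r • σ z :=
    Subtype.ext ((sgnSemilinear 𝒜).map_smulₛₗ r (z : E))
  -- `T` is the intersection of `N` with its image under the involution
  let T : Submodule Eᵐᵒᵖ S :=
    { carrier := {z | z ∈ N ∧ σ z ∈ N}
      zero_mem' := ⟨zero_mem _, by rw [map_zero]; exact zero_mem _⟩
      add_mem' := fun ha hb => ⟨add_mem ha.1 hb.1, by rw [map_add]; exact add_mem ha.2 hb.2⟩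
      smul_mem' := fun r z hz => ⟨N.smul_mem r hz.1, by
        rw [hσsmul]; exact N.smul_mem _ hz.2⟩ }
  have hT : T = ⊥ := by
    have hTh : (T.map S.subtype).IsHomogeneous 𝒜 := by
      rw [isHomogeneous_iff]
      rintro _ ⟨z, hz, rfl⟩
      exact ⟨σ z, ⟨hz.2, (hσσ z).symm ▸ hz.1⟩, rfl⟩
    rcases hS.eq_bot_or_eq _ hTh (Submodule.map_subtype_le S T) with h | h
    · exact Submodule.map_injective_of_injective S.subtype_injective (h.trans (Submodule.map_bot _).symm)
    · refine absurd (eq_top_iff.2 fun z _ => ?_) hN.1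
      have hz : (z : E) ∈ T.map S.subtype := h.symm ▸ z.2
      obtain ⟨w, hw, hwz⟩ := hz
      exact Subtype.ext hwz ▸ hw.1
  have hsimple : IsSimpleModule Eᵐᵒᵖ (S ⧸ N) := isSimpleModule_iff_isCoatom.2 hN
  have : RingHomSurjective (sgnOp 𝒜) := ⟨fun r => ⟨sgnOp 𝒜 r, sgnOp_sgnOp 𝒜 r⟩⟩
  let l : Twisted 𝒜 (S ⧸ N) →ₛₗ[sgnOp 𝒜] (S ⧸ N) :=
    { toFun := fun x => x
      map_add' := fun _ _ => rfl
      map_smul' := fun _ _ => rfl }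
  have : IsSimpleModule Eᵐᵒᵖ (Twisted 𝒜 (S ⧸ N)) :=
    (l.isSimpleModule_iff_of_bijective Function.bijective_id).2 hsimple
  let q : S →ₗ[Eᵐᵒᵖ] Twisted 𝒜 (S ⧸ N) :=
    { toFun := fun z => N.mkQ (σ z)
      map_add' := fun a b => by rw [map_add, map_add]; rfl
      map_smul' := fun r z => by rw [hσsmul, map_smul]; rfl }
  let f : S →ₗ[Eᵐᵒᵖ] (S ⧸ N) × Twisted 𝒜 (S ⧸ N) := N.mkQ.prod q
  have := isSemisimpleModule_prod (R := Eᵐᵒᵖ) (M := S ⧸ N) (N := Twisted 𝒜 (S ⧸ N))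
  refine IsSemisimpleModule.of_injective f ((injective_iff_map_eq_zero f).2 fun z hz => ?_)
  have hzT : z ∈ T := ⟨(Submodule.Quotient.mk_eq_zero N).1 (congrArg Prod.fst hz),
    (Submodule.Quotient.mk_eq_zero N).1 (congrArg Prod.snd hz)⟩
  rwa [hT, Submodule.mem_bot] at hzT

variable (𝒜) in
/-- The lattice of graded right ideals. -/
def homogeneousSublattice : CompleteSublattice (Submodule Eᵐᵒᵖ E) :=
  CompleteSublattice.mk' {S | S ≤ S.comap (sgnSemilinear 𝒜)}
    (fun s hs => by
      change sSup s ≤ (sSup s).comap _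
      exact sSup_le fun S hS x hx => (le_sSup hS : S ≤ sSup s) (hs hS hx))
    (fun _ hs _ hx => Submodule.mem_sInf.2 fun S hS => hs hS (Submodule.mem_sInf.1 hx S hS))

theorem mem_homogeneousSublattice {S : Submodule Eᵐᵒᵖ E} :
    S ∈ homogeneousSublattice 𝒜 ↔ S.IsHomogeneous 𝒜 :=
  (isHomogeneous_iff 𝒜).symm

instance : IsModularLattice (homogeneousSublattice 𝒜) where
  sup_inf_le_assoc_of_le {x} y {z} h := by
    exact IsModularLattice.sup_inf_le_assoc_of_le (y : Submodule Eᵐᵒᵖ E) h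

/-- A projection onto a graded submodule can be averaged to a graded one, whose kernel is a graded
complement. -/
theorem exists_homogeneous_isCompl [IsSemisimpleModule Eᵐᵒᵖ E] {S : Submodule Eᵐᵒᵖ E}
    (hS : S ∈ homogeneousSublattice 𝒜) : ∃ T ∈ homogeneousSublattice 𝒜, IsCompl S T := by
  obtain ⟨T', hT'⟩ := exists_isCompl S
  let self : GrMod 𝒜 := GrMod.ofInvolution 𝒜 E (sgn 𝒜).toLinearMap.toAddMonoidHom (sgn_sgn 𝒜)
    fun r x => (sgnSemilinear 𝒜).map_smulₛₗ r x
  have hinv (x : E) : self.inv x = sgn 𝒜 x := GrMod.inv_ofInvolution _ _ _ _ x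
  let p : E →ₗ[Eᵐᵒᵖ] E := S.subtype ∘ₗ S.projectionOnto T' hT'
  let q : E →ₗ[Eᵐᵒᵖ] E := (GrHom.average (M := self) (N := self) p).toLin
  have hq (x : E) : q x = half Eᵐᵒᵖ E (p x + sgn 𝒜 (p (sgn 𝒜 x))) := by
    rw [← hinv, ← hinv x]; rfl
  have hqS (x : E) : q x ∈ S := by
    rw [hq]
    exact S.smul_mem _ (add_mem (Subtype.mem _) (hS (Subtype.mem _)))
  have hqid (x : S) : q x = x := by
    have hp (x : E) (hx : x ∈ S) : p x = x :=
      congrArg Subtype.val (Submodule.projectionOnto_apply_left hT' ⟨x, hx⟩)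
    have hsx : p (sgn 𝒜 x) = sgn 𝒜 x := hp _ (hS x.2)
    rw [hq, hp _ x.2, hsx]
    exact (congrArg _ (congrArg _ (sgn_sgn 𝒜 (x : E)))).trans (half_map_add _ _)
  refine ⟨LinearMap.ker (q.codRestrict S hqS), fun x hx => ?_,
    LinearMap.isCompl_of_proj fun x => Subtype.ext (hqid x)⟩
  rw [LinearMap.ker_codRestrict] at hx ⊢
  have hx : q x = 0 := hx
  have := (GrHom.average (M := self) (N := self) p).inv_comm x
  rw [hinv] at this
  exact this.trans ((congrArg self.inv hx).trans (map_zero _))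

/-- A graded semisimple algebra is a sum of semisimple right ideals. Conversely, over a semisimple
algebra the lattice of graded right ideals is modular, complemented and noetherian, so that its top
element is the supremum of an independent set of atoms. -/
theorem isGrSemisimple_iff : IsGrSemisimple 𝒜 ↔ IsSemisimpleModule Eᵐᵒᵖ E := by
  classical
  constructor
  · rintro ⟨s, hs, hint⟩
    have (S : s) : IsSemisimpleModule Eᵐᵒᵖ (S : Submodule Eᵐᵒᵖ E) :=
      (hs S S.2).isSemisimpleModule
    exact isSemisimpleModule_of_isSemisimpleModule_submodule' this hint.submodule_iSup_eq_top
  · intro h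
    have : Module.Finite Eᵐᵒᵖ E :=
      Module.Finite.of_surjective (LinearMap.toSpanSingleton Eᵐᵒᵖ E 1)
        fun x => ⟨MulOpposite.op x, one_mul x⟩
    have : WellFoundedGT (homogeneousSublattice 𝒜) :=
      ⟨InvImage.wf (fun S : homogeneousSublattice 𝒜 => (S : Submodule Eᵐᵒᵖ E)) wellFounded_gt⟩
    have := CompleteLattice.isCompactlyGenerated_of_wellFoundedGT (α := homogeneousSublattice 𝒜)
    have : ComplementedLattice (homogeneousSublattice 𝒜) :=
      CompleteSublattice.isComplemented_iff.2 fun S hS => exists_homogeneous_isCompl hS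
    obtain ⟨s, hind, hsup, hatom⟩ := exists_sSupIndep_of_sSup_atoms_eq_top
      (sSup_atoms_eq_top (α := homogeneousSublattice 𝒜))
    have hind' : sSupIndep ((↑) '' s : Set (Submodule Eᵐᵒᵖ E)) := by
      rintro _ ⟨S, hS, rfl⟩
      have h := CompleteSublattice.disjoint_iff.1 (hind hS)
      rw [CompleteSublattice.coe_sSup'] at h
      refine h.mono_right (sSup_le ?_)
      rintro _ ⟨⟨T, hT, rfl⟩, hne⟩
      exact le_iSup₂_of_le T ⟨hT, fun h => hne (congrArg Subtype.val h)⟩ le_rfl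
    refine ⟨(↑) '' s, ?_, DirectSum.isInternal_submodule_of_iSupIndep_of_iSup_eq_top
      ((sSupIndep_iff _).1 hind') ?_⟩
    · rintro _ ⟨S, hS, rfl⟩
      refine ⟨mem_homogeneousSublattice.1 S.2, fun h => (hatom hS).1 (Subtype.ext h),
        fun T hT hTS => ?_⟩
      have h := (hatom hS).le_iff.1
        (show (⟨T, mem_homogeneousSublattice.2 hT⟩ : homogeneousSublattice 𝒜) ≤ S from hTS)
      exact h.imp (congrArg Subtype.val) (congrArg Subtype.val)
    · rw [← sSup_eq_iSup', sSup_image, ← CompleteSublattice.coe_sSup', hsup]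
      rfl

variable (E) in
/-- The right regular module is the left regular module of the opposite ring. -/
def opEquiv : E ≃ₗ[Eᵐᵒᵖ] Eᵐᵒᵖ :=
  { MulOpposite.opAddEquiv with map_smul' := fun _ _ => rfl }

/-- Both conditions say that all right modules are projective. -/
theorem isGrSemisimple_iff_grGlobalDim_eq_zero :
    IsGrSemisimple 𝒜 ↔ grGlobalDim 𝒜 = 0 := by
  rw [isGrSemisimple_iff, ← nonpos_iff_eq_zero, ← Nat.cast_zero, grGlobalDim_le_iff]
  simp only [projDimLE_zero]
  constructor
  · intro h V _ _
    have : IsSemisimpleRing Eᵐᵒᵖ := IsSemisimpleModule.congr (opEquiv E).symm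
    exact Module.projective_of_isSemisimpleRing _ _
  · intro h
    refine { toComplementedLattice := ⟨fun S => ?_⟩ }
    have := h (E ⧸ S)
    -- the quotient map of `S` splits as `E ⧸ S` is projective, giving a complement of `S`
    obtain ⟨t, ht⟩ := Module.projective_lifting_property S.mkQ LinearMap.id S.mkQ_surjective
    have ht' (y : E ⧸ S) : S.mkQ (t y) = y := LinearMap.congr_fun ht y
    have hidem : IsIdempotentElem (t ∘ₗ S.mkQ) := LinearMap.ext fun x => congrArg t (ht' _)
    have hker : LinearMap.ker (t ∘ₗ S.mkQ) = S := by
      rw [LinearMap.ker_comp_of_ker_eq_bot _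
        (LinearMap.ker_eq_bot.2 (Function.LeftInverse.injective ht')), Submodule.ker_mkQ]
    exact ⟨_, (hker ▸ LinearMap.IsIdempotentElem.isCompl hidem).symm⟩

end Semisimple

/-! ### Change of rings -/

section ChangeOfRings

variable {R S : Type u} [Ring R] [Ring S] (ι : R →+* S)

/-- A linear map over `S` as a linear map over a ring acting through `S`. -/
def restrictLin {M N : Type*} [AddCommGroup M] [Module S M] [Module R M] [AddCommGroup N]
    [Module S N] [Module R N] (hM : ∀ (r : R) (x : M), r • x = ι r • x)
    (hN : ∀ (r : R) (x : N), r • x = ι r • x) (f : M →ₗ[S] N) : M →ₗ[R] N where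
  toFun := f
  map_add' := map_add f
  map_smul' r x := by rw [hM, map_smul, RingHom.id_apply, hN]

/-- If `S` is projective over `R`, then so is every projective `S`-module. -/
theorem projective_of_projective [Module R S] (hS : ∀ (r : R) (x : S), r • x = ι r • x)
    [Module.Projective R S] {N : Type u} [AddCommGroup N] [Module S N] [Module R N]
    (hN : ∀ (r : R) (x : N), r • x = ι r • x) [Module.Projective S N] : Module.Projective R N := by
  obtain ⟨s, hs⟩ := Module.projective_lifting_property
    (Finsupp.linearCombination S (id : N → N)) LinearMap.id
    (Finsupp.linearCombination_id_surjective S N)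
  have hF (r : R) (x : N →₀ S) : r • x = ι r • x := Finsupp.ext fun n => hS r (x n)
  classical
  have : Module.Projective R (N →₀ S) := Module.Projective.of_equiv (finsuppLequivDFinsupp R).symm
  exact Module.Projective.of_split (restrictLin ι hN hF s)
    (restrictLin ι hF hN (Finsupp.linearCombination S (id : N → N)))
    (LinearMap.ext fun x => LinearMap.congr_fun hs x)

/-- If the same `S`-modules are projective over `R` and over `S`, then projective dimensions over `R`
and over `S` agree, by dimension shifting along a free `S`-module. -/
theorem projDimLE_iff_of_projective_iff
    (H : ∀ (N : Type u) [AddCommGroup N] [Module S N] [Module R N],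
      (∀ (r : R) (x : N), r • x = ι r • x) → (Module.Projective S N ↔ Module.Projective R N))
    {N : Type u} [AddCommGroup N] [Module S N] [Module R N]
    (hN : ∀ (r : R) (x : N), r • x = ι r • x) {n : ℕ} : ProjDimLE S N n ↔ ProjDimLE R N n := by
  induction n generalizing N with
  | zero => rw [projDimLE_zero, projDimLE_zero, H N hN]
  | succ n ih =>
    let q := Finsupp.linearCombination S (id : N → N)
    have hq : Function.Surjective q := Finsupp.linearCombination_id_surjective S N
    let _ : Module R (N →₀ S) := Module.compHom _ ι
    let _ : Module R (LinearMap.ker q) := Module.compHom _ ι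
    have : Module.Projective R (N →₀ S) := (H (N →₀ S) fun _ _ => rfl).1 inferInstance
    have hS : ProjDimLE S N (n + 1) ↔ ProjDimLE S (LinearMap.ker q) n :=
      projDimLE_succ (LinearMap.ker q).subtype_injective hq q.exact_subtype_ker_map n
    rw [hS, ih (N := LinearMap.ker q) fun _ _ => rfl]
    let j := restrictLin (R := R) (M := LinearMap.ker q) (N := N →₀ S) ι (fun _ _ => rfl)
      (fun _ _ => rfl) (LinearMap.ker q).subtype
    let p := restrictLin (R := R) (M := N →₀ S) (N := N) ι (fun _ _ => rfl) hN q
    have hj : Function.Injective j := (LinearMap.ker q).subtype_injective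
    have hjp : Function.Exact j p := q.exact_subtype_ker_map
    exact (projDimLE_succ (g := p) hj hq hjp n).symm

end ChangeOfRings

/-! ### Separability idempotents -/

section Separability

/-- `e = ∑ xᵢ ⊗ yᵢ` is a separability idempotent of `F`: `∑ xᵢ yᵢ = 1`, and
`∑ f xᵢ ⊗ yᵢ = ∑ xᵢ ⊗ yᵢ f` for all `f`. -/
structure IsSeparabilityIdempotent {F : Type*} [Ring F] [Algebra ℂ F] (e : F ⊗[ℂ] F) : Prop where
  mul_eq_one : LinearMap.mul' ℂ F e = 1
  comm : ∀ f : F, TensorProduct.map (LinearMap.mulLeft ℂ f) LinearMap.id e =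
    TensorProduct.map LinearMap.id (LinearMap.mulRight ℂ f) e

theorem IsSeparabilityIdempotent.map {F G : Type*} [Ring F] [Algebra ℂ F] [Ring G] [Algebra ℂ G]
    {e : F ⊗[ℂ] F} (he : IsSeparabilityIdempotent e) (φ : F ≃ₐ[ℂ] G) :
    IsSeparabilityIdempotent (TensorProduct.map φ.toLinearMap φ.toLinearMap e) where
  mul_eq_one := by
    have h : LinearMap.mul' ℂ G ∘ₗ TensorProduct.map φ.toLinearMap φ.toLinearMap =
        φ.toLinearMap ∘ₗ LinearMap.mul' ℂ F := TensorProduct.ext' fun x y => by simp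
    have h' := LinearMap.congr_fun h e
    rw [LinearMap.comp_apply, LinearMap.comp_apply, he.mul_eq_one] at h'
    exact h'.trans (map_one φ)
  comm g := by
    obtain ⟨f, rfl⟩ := φ.surjective g
    have h1 : TensorProduct.map (LinearMap.mulLeft ℂ (φ f)) LinearMap.id ∘ₗ
        TensorProduct.map φ.toLinearMap φ.toLinearMap =
        TensorProduct.map φ.toLinearMap φ.toLinearMap ∘ₗ
          TensorProduct.map (LinearMap.mulLeft ℂ f) LinearMap.id :=
      TensorProduct.ext' fun x y => by simp
    have h2 : TensorProduct.map LinearMap.id (LinearMap.mulRight ℂ (φ f)) ∘ₗ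
        TensorProduct.map φ.toLinearMap φ.toLinearMap =
        TensorProduct.map φ.toLinearMap φ.toLinearMap ∘ₗ
          TensorProduct.map LinearMap.id (LinearMap.mulRight ℂ f) :=
      TensorProduct.ext' fun x y => by simp
    exact (LinearMap.congr_fun h1 e).trans ((congrArg _ (he.comm f)).trans
      (LinearMap.congr_fun h2 e).symm)

/-- A finite product of matrix algebras has the separability idempotent `∑ eᵃ⁰ ⊗ e⁰ᵃ`, the sum
being over the rows `a` of all factors. -/
theorem isSeparabilityIdempotent_pi_matrix {n : ℕ} (d : Fin n → ℕ) [∀ i, NeZero (d i)] :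
    IsSeparabilityIdempotent (F := ∀ i, Matrix (Fin (d i)) (Fin (d i)) ℂ)
      (∑ i, ∑ a, Pi.single i (Matrix.single a 0 1) ⊗ₜ Pi.single i (Matrix.single 0 a 1)) where
  mul_eq_one := by
    simp only [map_sum, LinearMap.mul'_apply, ← Pi.single_mul, Matrix.single_mul_single_same,
      mul_one]
    funext i
    simp only [Finset.sum_apply, Pi.one_apply]
    rw [Finset.sum_eq_single i]
    · simp only [Pi.single_eq_same]
      exact (Matrix.sum_single_eq_diagonal (fun _ => 1)).trans Matrix.diagonal_one
    · intro j _ hj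
      simp [Pi.single_eq_of_ne hj.symm]
    · simp
  comm f := by
    simp only [map_sum, TensorProduct.map_tmul, LinearMap.mulLeft_apply, LinearMap.mulRight_apply,
      LinearMap.id_apply]
    refine Finset.sum_congr rfl fun i _ => ?_
    have hl (a : Fin (d i)) : f * Pi.single i (Matrix.single a 0 1) =
        ∑ b, f i b a • (Pi.single i (Matrix.single b 0 1) :
          ∀ i, Matrix (Fin (d i)) (Fin (d i)) ℂ) := by
      simp only [← Pi.single_smul]
      funext j
      rw [Finset.sum_apply]
      rcases eq_or_ne j i with rfl | hj
      · simp only [Pi.mul_apply, Pi.single_eq_same]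
        ext b c
        by_cases h : 0 = c <;> simp [Matrix.mul_apply, Matrix.sum_apply, Matrix.single_apply, h]
      · simp [hj]
    have hr (a : Fin (d i)) : Pi.single i (Matrix.single 0 a 1) * f =
        ∑ b, f i a b • (Pi.single i (Matrix.single 0 b 1) :
          ∀ i, Matrix (Fin (d i)) (Fin (d i)) ℂ) := by
      simp only [← Pi.single_smul]
      funext j
      rw [Finset.sum_apply]
      rcases eq_or_ne j i with rfl | hj
      · simp only [Pi.mul_apply, Pi.single_eq_same]
        ext b c
        by_cases h : 0 = b <;> simp [Matrix.mul_apply, Matrix.sum_apply, Matrix.single_apply, h]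
      · simp [hj]
    simp only [hl, hr, TensorProduct.sum_tmul, TensorProduct.tmul_sum, TensorProduct.smul_tmul]
    exact Finset.sum_comm

theorem exists_isSeparabilityIdempotent (F : Type*) [Ring F] [Algebra ℂ F] [FiniteDimensional ℂ F]
    [IsSemisimpleRing F] : ∃ e : F ⊗[ℂ] F, IsSeparabilityIdempotent e := by
  obtain ⟨n, d, hd, ⟨φ⟩⟩ := IsSemisimpleRing.exists_algEquiv_pi_matrix_of_isAlgClosed ℂ F
  exact ⟨_, (isSeparabilityIdempotent_pi_matrix d).map φ.symm⟩

/-- The average of a separability idempotent and of its conjugate by the grading involution is even,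
that is, invariant under the involution. -/
theorem exists_even_isSeparabilityIdempotent {F : Type u} [Ring F] [Algebra ℂ F]
    (ℬ : ZMod 2 → Submodule ℂ F) [GradedAlgebra ℬ] [FiniteDimensional ℂ F] [IsSemisimpleRing F] :
    ∃ e : F ⊗[ℂ] F, IsSeparabilityIdempotent e ∧
      TensorProduct.map (sgn ℬ).toLinearMap (sgn ℬ).toLinearMap e = e := by
  obtain ⟨e, he⟩ := exists_isSeparabilityIdempotent F
  have hinv : (sgn ℬ).comp (sgn ℬ) = AlgHom.id ℂ F := AlgHom.ext (sgn_sgn ℬ)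
  have he' := he.map (AlgEquiv.ofAlgHom (sgn ℬ) (sgn ℬ) hinv hinv)
  set τ : F ⊗[ℂ] F →ₗ[ℂ] F ⊗[ℂ] F :=
    TensorProduct.map (sgn ℬ).toLinearMap (sgn ℬ).toLinearMap with hτ
  have hττ : τ (τ e) = e := by
    have h : τ ∘ₗ τ = LinearMap.id := TensorProduct.ext' fun x y => by simp [hτ]
    exact LinearMap.congr_fun h e
  change IsSeparabilityIdempotent (τ e) at he'
  refine ⟨(2⁻¹ : ℂ) • (e + τ e), ⟨?_, fun f => ?_⟩, ?_⟩
  · rw [map_smul, map_add, he.mul_eq_one, he'.mul_eq_one]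
    module
  · rw [map_smul, map_smul, map_add, map_add, he.comm, he'.comm]
  · rw [map_smul, map_add, hττ, add_comm]

end Separability

/-! ### The twisted tensor product as a right module -/

section Twist

variable {E F : Type u} [Ring E] [Algebra ℂ E] [Ring F] [Algebra ℂ F]
  (𝒜 : ZMod 2 → Submodule ℂ E) [GradedAlgebra 𝒜]
  (ℬ : ZMod 2 → Submodule ℂ F) [GradedAlgebra ℬ]

open GradedTensorProduct

theorem includeRight_mul_includeLeft_of_mem_zero {a : E} (ha : a ∈ 𝒜 0) (x : F) :
    includeRight 𝒜 ℬ x * includeLeft 𝒜 ℬ a = includeLeft 𝒜 ℬ a * includeRight 𝒜 ℬ x := by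
  rw [includeLeft_apply, includeRight_apply, tmul_one_mul_one_tmul]
  obtain ⟨y, hy, z, hz, rfl⟩ := exists_eq_add_of_grading ℬ x
  have h0 := tmul_coe_mul_zero_coe_tmul (R := ℂ) 𝒜 ℬ 1 ⟨y, hy⟩ ⟨a, ha⟩ 1
  have h1 := tmul_coe_mul_zero_coe_tmul (R := ℂ) 𝒜 ℬ 1 ⟨z, hz⟩ ⟨a, ha⟩ 1
  simp only [one_mul, mul_one] at h0 h1
  simp only [tmul, TensorProduct.tmul_add, map_add, add_mul] at h0 h1 ⊢
  rw [h0, h1]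

theorem includeRight_mul_includeLeft_of_mem_one {a : E} (ha : a ∈ 𝒜 1) (x : F) :
    includeRight 𝒜 ℬ x * includeLeft 𝒜 ℬ a =
      includeLeft 𝒜 ℬ a * includeRight 𝒜 ℬ (sgn ℬ x) := by
  rw [includeLeft_apply, includeRight_apply, includeRight_apply, tmul_one_mul_one_tmul]
  obtain ⟨y, hy, z, hz, rfl⟩ := exists_eq_add_of_grading ℬ x
  have h0 := tmul_coe_mul_coe_tmul (R := ℂ) 𝒜 ℬ 1 ⟨y, hy⟩ ⟨a, ha⟩ 1
  have h1 := tmul_coe_mul_coe_tmul (R := ℂ) 𝒜 ℬ 1 ⟨z, hz⟩ ⟨a, ha⟩ 1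
  rw [zero_mul, uzpow_zero, one_smul] at h0
  rw [one_mul, uzpow_one, Units.neg_smul, one_smul] at h1
  simp only [one_mul, mul_one] at h0 h1
  rw [map_add, sgn_of_mem_zero ℬ hy, sgn_of_mem_one ℬ hz]
  simp only [tmul, TensorProduct.tmul_add, TensorProduct.tmul_neg, map_add, map_neg, add_mul]
    at h0 h1 ⊢
  rw [h0, h1]

/-- The inclusion of `E` in the twisted tensor product, on the opposite rings. -/
def leftOp : Eᵐᵒᵖ →+* (𝒜 ᵍ⊗[ℂ] ℬ)ᵐᵒᵖ := (includeLeft 𝒜 ℬ).toRingHom.op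

/-- The inclusion of `F` in the twisted tensor product, as a map to the opposite ring. -/
def rightOp : F →ₗ[ℂ] (𝒜 ᵍ⊗[ℂ] ℬ)ᵐᵒᵖ :=
  (MulOpposite.opLinearEquiv ℂ).toLinearMap ∘ₗ (includeRight 𝒜 ℬ).toLinearMap

theorem rightOp_one : rightOp 𝒜 ℬ 1 = 1 :=
  congrArg MulOpposite.op (map_one (includeRight 𝒜 ℬ))

theorem rightOp_mul (x y : F) : rightOp 𝒜 ℬ (x * y) = rightOp 𝒜 ℬ y * rightOp 𝒜 ℬ x :=
  congrArg MulOpposite.op (map_mul (includeRight 𝒜 ℬ) x y)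

theorem leftOp_mul_rightOp_of_mem_zero {a : E} (ha : a ∈ 𝒜 0) (x : F) :
    leftOp 𝒜 ℬ (MulOpposite.op a) * rightOp 𝒜 ℬ x =
      rightOp 𝒜 ℬ x * leftOp 𝒜 ℬ (MulOpposite.op a) :=
  congrArg MulOpposite.op (includeRight_mul_includeLeft_of_mem_zero 𝒜 ℬ ha x)

theorem leftOp_mul_rightOp_of_mem_one {a : E} (ha : a ∈ 𝒜 1) (x : F) :
    leftOp 𝒜 ℬ (MulOpposite.op a) * rightOp 𝒜 ℬ x =
      rightOp 𝒜 ℬ (sgn ℬ x) * leftOp 𝒜 ℬ (MulOpposite.op a) :=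
  congrArg MulOpposite.op (includeRight_mul_includeLeft_of_mem_one 𝒜 ℬ ha x)

/-- The opposite of the twisted tensor product is additively generated by the products of elements
of `F` and `E`. -/
theorem op_twist_induction {p : (𝒜 ᵍ⊗[ℂ] ℬ)ᵐᵒᵖ → Prop} (h0 : p 0)
    (hadd : ∀ s t, p s → p t → p (s + t))
    (hmul : ∀ (r : Eᵐᵒᵖ) (x : F), p (rightOp 𝒜 ℬ x * leftOp 𝒜 ℬ r)) (s : (𝒜 ᵍ⊗[ℂ] ℬ)ᵐᵒᵖ) :
    p s := by
  obtain ⟨t, rfl⟩ := MulOpposite.op_surjective s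
  obtain ⟨y, rfl⟩ := (GradedTensorProduct.of ℂ 𝒜 ℬ).surjective t
  induction y with
  | zero => simpa using h0
  | add y z hy hz => rw [map_add, MulOpposite.op_add]; exact hadd _ _ hy hz
  | tmul a b =>
    have h := hmul (MulOpposite.op a) b
    have h' : rightOp 𝒜 ℬ b * leftOp 𝒜 ℬ (MulOpposite.op a) =
        MulOpposite.op (GradedTensorProduct.of ℂ 𝒜 ℬ (a ⊗ₜ b)) :=
      congrArg MulOpposite.op (tmul_one_mul_one_tmul (R := ℂ) 𝒜 ℬ a b)
    rwa [h'] at h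

/-- The braiding of the twisted tensor product reverses the order of the factors. -/
theorem comm_tmul (x : E) (y : F) :
    comm ℬ 𝒜 (tmul ℂ y x) = includeRight 𝒜 ℬ y * includeLeft 𝒜 ℬ x := by
  have hr : comm ℬ 𝒜 (tmul ℂ y 1) = includeRight 𝒜 ℬ y := by
    obtain ⟨b, hb, c, hc, rfl⟩ := exists_eq_add_of_grading ℬ y
    have h0 := comm_coe_tmul_coe (R := ℂ) ℬ 𝒜 ⟨b, hb⟩ ⟨1, SetLike.GradedOne.one_mem⟩
    have h1 := comm_coe_tmul_coe (R := ℂ) ℬ 𝒜 ⟨c, hc⟩ ⟨1, SetLike.GradedOne.one_mem⟩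
    rw [zero_mul, uzpow_zero, one_smul] at h0 h1
    simp only [tmul, TensorProduct.add_tmul, map_add, includeRight_apply] at h0 h1 ⊢
    rw [h0, h1]
  have hl : comm ℬ 𝒜 (tmul ℂ 1 x) = includeLeft 𝒜 ℬ x := by
    obtain ⟨b, hb, c, hc, rfl⟩ := exists_eq_add_of_grading 𝒜 x
    have h0 := comm_coe_tmul_coe (R := ℂ) ℬ 𝒜 ⟨1, SetLike.GradedOne.one_mem⟩ ⟨b, hb⟩
    have h1 := comm_coe_tmul_coe (R := ℂ) ℬ 𝒜 ⟨1, SetLike.GradedOne.one_mem⟩ ⟨c, hc⟩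
    rw [mul_zero, uzpow_zero, one_smul] at h0 h1
    simp only [tmul, map_add, includeLeft_apply,
      TensorProduct.tmul_add] at h0 h1 ⊢
    rw [h0, h1]
  rw [← tmul_one_mul_one_tmul, map_mul, hr, hl]

/-- The twisted tensor product is projective as a right `E`-module: by the braiding, every element is
uniquely a sum of elements `(1 ⊗ y) (x ⊗ 1)`, on which `E` acts by right multiplication on `x`. -/
theorem projective_op_twist [Module Eᵐᵒᵖ (𝒜 ᵍ⊗[ℂ] ℬ)ᵐᵒᵖ]
    (h : ∀ (r : Eᵐᵒᵖ) (s : (𝒜 ᵍ⊗[ℂ] ℬ)ᵐᵒᵖ), r • s = leftOp 𝒜 ℬ r * s) :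
    Module.Projective Eᵐᵒᵖ (𝒜 ᵍ⊗[ℂ] ℬ)ᵐᵒᵖ := by
  let φ : E ⊗[ℂ] F ≃ₗ[ℂ] (𝒜 ᵍ⊗[ℂ] ℬ)ᵐᵒᵖ :=
    TensorProduct.comm ℂ E F ≪≫ₗ GradedTensorProduct.of ℂ ℬ 𝒜 ≪≫ₗ
      (comm ℬ 𝒜).toLinearEquiv ≪≫ₗ MulOpposite.opLinearEquiv ℂ
  have hφ (x : E) (y : F) : φ (x ⊗ₜ y) = leftOp 𝒜 ℬ (MulOpposite.op x) * rightOp 𝒜 ℬ y :=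
    congrArg MulOpposite.op (comm_tmul 𝒜 ℬ x y)
  let ψ : E ⊗[ℂ] F ≃ₗ[Eᵐᵒᵖ] (𝒜 ᵍ⊗[ℂ] ℬ)ᵐᵒᵖ :=
    { φ with
      map_smul' := fun r z => by
        change φ (r • z) = r • φ z
        induction z with
        | zero => rw [smul_zero, map_zero, smul_zero]
        | add z w hz hw => rw [smul_add, map_add, hz, hw, map_add, smul_add]
        | tmul x y =>
          rw [TensorProduct.smul_tmul', hφ, hφ, h, ← mul_assoc, ← map_mul]
          rfl }
  have : Module.Projective Eᵐᵒᵖ E := Module.Projective.of_equiv (opEquiv E).symm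
  exact Module.Projective.of_equiv ψ

end Twist

/-! ### Relative projectivity -/

section Relative

variable {E F : Type u} [Ring E] [Algebra ℂ E] [Ring F] [Algebra ℂ F]
  (𝒜 : ZMod 2 → Submodule ℂ E) [GradedAlgebra 𝒜]
  (ℬ : ZMod 2 → Submodule ℂ F) [GradedAlgebra ℬ]

section Reynolds

variable {P N : Type u} [AddCommGroup P] [Module ℂ P] [Module (𝒜 ᵍ⊗[ℂ] ℬ)ᵐᵒᵖ P]
  [IsScalarTower ℂ (𝒜 ᵍ⊗[ℂ] ℬ)ᵐᵒᵖ P] [AddCommGroup N] [Module ℂ N] [Module (𝒜 ᵍ⊗[ℂ] ℬ)ᵐᵒᵖ N]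
  [IsScalarTower ℂ (𝒜 ᵍ⊗[ℂ] ℬ)ᵐᵒᵖ N]

variable (P) in
/-- The action of `F` on a right module over the twisted tensor product. -/
def actF : F →ₗ[ℂ] P →ₗ[ℂ] P :=
  (Algebra.lsmul ℂ ℂ P : (𝒜 ᵍ⊗[ℂ] ℬ)ᵐᵒᵖ →ₐ[ℂ] Module.End ℂ P).toLinearMap ∘ₗ rightOp 𝒜 ℬ

/-- For `e = ∑ xᵢ ⊗ yᵢ` in `F ⊗ F`, the map `n ↦ ∑ h (n xᵢ) yᵢ`. -/
def reynolds (h : P →ₗ[ℂ] N) : F ⊗[ℂ] F →ₗ[ℂ] P →ₗ[ℂ] N :=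
  TensorProduct.lift (LinearMap.mk₂ ℂ (fun x y => actF 𝒜 ℬ N y ∘ₗ h ∘ₗ actF 𝒜 ℬ P x)
    (fun x x' y => by rw [map_add, LinearMap.comp_add, LinearMap.comp_add])
    (fun c x y => by rw [map_smul, LinearMap.comp_smul, LinearMap.comp_smul])
    (fun x y y' => by rw [map_add, LinearMap.add_comp])
    (fun c x y => by rw [map_smul, LinearMap.smul_comp]))

theorem reynolds_tmul (h : P →ₗ[ℂ] N) (x y : F) (n : P) :
    reynolds 𝒜 ℬ h (x ⊗ₜ y) n = rightOp 𝒜 ℬ y • h (rightOp 𝒜 ℬ x • n) := rfl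

theorem reynolds_mulLeft (h : P →ₗ[ℂ] N) (f : F) (e : F ⊗[ℂ] F) (n : P) :
    reynolds 𝒜 ℬ h (TensorProduct.map (LinearMap.mulLeft ℂ f) LinearMap.id e) n =
      reynolds 𝒜 ℬ h e (rightOp 𝒜 ℬ f • n) := by
  induction e with
  | zero => simp only [map_zero, LinearMap.zero_apply]
  | add e e' he he' => simp only [map_add, LinearMap.add_apply, he, he']
  | tmul x y =>
    rw [TensorProduct.map_tmul, reynolds_tmul, reynolds_tmul, LinearMap.mulLeft_apply,
      rightOp_mul, mul_smul, LinearMap.id_apply]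

theorem reynolds_mulRight (h : P →ₗ[ℂ] N) (f : F) (e : F ⊗[ℂ] F) (n : P) :
    reynolds 𝒜 ℬ h (TensorProduct.map LinearMap.id (LinearMap.mulRight ℂ f) e) n =
      rightOp 𝒜 ℬ f • reynolds 𝒜 ℬ h e n := by
  induction e with
  | zero => simp only [map_zero, LinearMap.zero_apply, smul_zero]
  | add e e' he he' => simp only [map_add, LinearMap.add_apply, he, he', smul_add]
  | tmul x y =>
    rw [TensorProduct.map_tmul, reynolds_tmul, reynolds_tmul, LinearMap.mulRight_apply,
      rightOp_mul, mul_smul, LinearMap.id_apply]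

/-- An `a` of degree `0` commutes with `F`, so it can be moved out of `∑ h (n a xᵢ) yᵢ`. -/
theorem reynolds_leftOp_of_mem_zero {h : P →ₗ[ℂ] N}
    (hE : ∀ (r : Eᵐᵒᵖ) (n : P), h (leftOp 𝒜 ℬ r • n) = leftOp 𝒜 ℬ r • h n) {a : E} (ha : a ∈ 𝒜 0)
    (e : F ⊗[ℂ] F) (n : P) :
    reynolds 𝒜 ℬ h e (leftOp 𝒜 ℬ (MulOpposite.op a) • n) =
      leftOp 𝒜 ℬ (MulOpposite.op a) • reynolds 𝒜 ℬ h e n := by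
  induction e with
  | zero => simp only [map_zero, LinearMap.zero_apply, smul_zero]
  | add e e' he he' => simp only [map_add, LinearMap.add_apply, he, he', smul_add]
  | tmul x y =>
    rw [reynolds_tmul, reynolds_tmul, smul_smul (rightOp 𝒜 ℬ x),
      ← leftOp_mul_rightOp_of_mem_zero 𝒜 ℬ ha, mul_smul, hE, smul_smul (rightOp 𝒜 ℬ y),
      ← leftOp_mul_rightOp_of_mem_zero 𝒜 ℬ ha, mul_smul]

/-- Moving an `a` of degree `1` out of `∑ h (n a xᵢ) yᵢ` applies the grading involution to both `xᵢ`
and `yᵢ`. -/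
theorem reynolds_leftOp_of_mem_one {h : P →ₗ[ℂ] N}
    (hE : ∀ (r : Eᵐᵒᵖ) (n : P), h (leftOp 𝒜 ℬ r • n) = leftOp 𝒜 ℬ r • h n) {a : E} (ha : a ∈ 𝒜 1)
    (e : F ⊗[ℂ] F) (n : P) :
    reynolds 𝒜 ℬ h (TensorProduct.map (sgn ℬ).toLinearMap (sgn ℬ).toLinearMap e)
        (leftOp 𝒜 ℬ (MulOpposite.op a) • n) =
      leftOp 𝒜 ℬ (MulOpposite.op a) • reynolds 𝒜 ℬ h e n := by
  induction e with
  | zero => simp only [map_zero, LinearMap.zero_apply, smul_zero]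
  | add e e' he he' => simp only [map_add, LinearMap.add_apply, he, he', smul_add]
  | tmul x y =>
    rw [TensorProduct.map_tmul, AlgHom.toLinearMap_apply, AlgHom.toLinearMap_apply,
      reynolds_tmul, reynolds_tmul, smul_smul (rightOp 𝒜 ℬ (sgn ℬ x)),
      ← leftOp_mul_rightOp_of_mem_one 𝒜 ℬ ha, mul_smul, hE, smul_smul (rightOp 𝒜 ℬ (sgn ℬ y)),
      ← leftOp_mul_rightOp_of_mem_one 𝒜 ℬ ha, mul_smul]

variable {ℬ} in
/-- For an even separability idempotent `e = ∑ xᵢ ⊗ yᵢ`, the map `n ↦ ∑ h (n xᵢ) yᵢ` is linear over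
the twisted tensor product as soon as `h` is linear over `E`. -/
def reynoldsLinear {e : F ⊗[ℂ] F} (he : IsSeparabilityIdempotent e)
    (heven : TensorProduct.map (sgn ℬ).toLinearMap (sgn ℬ).toLinearMap e = e) (h : P →ₗ[ℂ] N)
    (hE : ∀ (r : Eᵐᵒᵖ) (n : P), h (leftOp 𝒜 ℬ r • n) = leftOp 𝒜 ℬ r • h n) :
    P →ₗ[(𝒜 ᵍ⊗[ℂ] ℬ)ᵐᵒᵖ] N where
  toFun := reynolds 𝒜 ℬ h e
  map_add' := map_add _
  map_smul' s n := by
    rw [RingHom.id_apply]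
    induction s using op_twist_induction generalizing n with
    | h0 => rw [zero_smul, zero_smul, map_zero]
    | hadd s t hs ht => rw [add_smul, add_smul, map_add, hs, ht]
    | hmul r x =>
      rw [mul_smul, mul_smul, ← reynolds_mulLeft, he.comm, reynolds_mulRight]
      congr 1
      obtain ⟨a, rfl⟩ := MulOpposite.op_surjective r
      obtain ⟨b, hb, c, hc, rfl⟩ := exists_eq_add_of_grading 𝒜 a
      have hc' := reynolds_leftOp_of_mem_one 𝒜 ℬ hE hc e n
      rw [heven] at hc'
      rw [MulOpposite.op_add, map_add, add_smul, add_smul, map_add,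
        reynolds_leftOp_of_mem_zero 𝒜 ℬ hE hb, hc']

theorem map_reynolds {h : P →ₗ[ℂ] N} {g : N →ₗ[(𝒜 ᵍ⊗[ℂ] ℬ)ᵐᵒᵖ] P} (hg : ∀ n, g (h n) = n)
    (e : F ⊗[ℂ] F) (n : P) :
    g (reynolds 𝒜 ℬ h e n) = rightOp 𝒜 ℬ (LinearMap.mul' ℂ F e) • n := by
  induction e with
  | zero => simp only [map_zero, LinearMap.zero_apply, zero_smul]
  | add e e' he he' => simp only [map_add, LinearMap.add_apply, he, he', add_smul]
  | tmul x y =>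
    rw [reynolds_tmul, map_smul, hg, smul_smul, LinearMap.mul'_apply, rightOp_mul]

end Reynolds

/-- A module over the twisted tensor product is projective iff it is projective over `E`. -/
theorem projective_twist_iff [FiniteDimensional ℂ F] [IsSemisimpleRing F] (P : Type u)
    [AddCommGroup P] [Module (𝒜 ᵍ⊗[ℂ] ℬ)ᵐᵒᵖ P] [Module Eᵐᵒᵖ P]
    (hP : ∀ (r : Eᵐᵒᵖ) (n : P), r • n = leftOp 𝒜 ℬ r • n) :
    Module.Projective (𝒜 ᵍ⊗[ℂ] ℬ)ᵐᵒᵖ P ↔ Module.Projective Eᵐᵒᵖ P := by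
  constructor
  · intro _
    let _ : Module Eᵐᵒᵖ (𝒜 ᵍ⊗[ℂ] ℬ)ᵐᵒᵖ := Module.compHom _ (leftOp 𝒜 ℬ)
    have := projective_op_twist 𝒜 ℬ fun _ _ => rfl
    exact projective_of_projective (leftOp 𝒜 ℬ) (fun _ _ => rfl) hP
  · intro _
    obtain ⟨e, he, heven⟩ := exists_even_isSeparabilityIdempotent ℬ
    let _ : Module ℂ P := Module.compHom P (algebraMap ℂ (𝒜 ᵍ⊗[ℂ] ℬ)ᵐᵒᵖ)
    have : IsScalarTower ℂ (𝒜 ᵍ⊗[ℂ] ℬ)ᵐᵒᵖ P := IsScalarTower.of_algebraMap_smul fun _ _ => rfl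
    let _ : Module Eᵐᵒᵖ (P →₀ (𝒜 ᵍ⊗[ℂ] ℬ)ᵐᵒᵖ) := Module.compHom _ (leftOp 𝒜 ℬ)
    let q := Finsupp.linearCombination (𝒜 ᵍ⊗[ℂ] ℬ)ᵐᵒᵖ (id : P → P)
    have hq : Function.Surjective q := Finsupp.linearCombination_id_surjective _ P
    -- an `E`-linear section of `q`, to be averaged to a linear one
    obtain ⟨h, hh⟩ := Module.projective_lifting_property
      (restrictLin (leftOp 𝒜 ℬ) (fun _ _ => rfl) hP q) LinearMap.id hq
    have hE (r : Eᵐᵒᵖ) (n : P) : h (leftOp 𝒜 ℬ r • n) = leftOp 𝒜 ℬ r • h n := by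
      rw [← hP, map_smul]; rfl
    let hℂ : P →ₗ[ℂ] (P →₀ (𝒜 ᵍ⊗[ℂ] ℬ)ᵐᵒᵖ) :=
      { toFun := h
        map_add' := map_add h
        map_smul' := fun c n => by
          rw [← algebraMap_smul (𝒜 ᵍ⊗[ℂ] ℬ)ᵐᵒᵖ c n]
          refine (hE (algebraMap ℂ Eᵐᵒᵖ c) n).trans ?_
          exact algebraMap_smul (𝒜 ᵍ⊗[ℂ] ℬ)ᵐᵒᵖ c (h n) }
    refine Module.Projective.of_split (reynoldsLinear 𝒜 he heven hℂ hE) q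
      (LinearMap.ext fun n => ?_)
    refine (map_reynolds 𝒜 ℬ (h := hℂ) (g := q) (fun n => LinearMap.congr_fun hh n) e n).trans ?_
    rw [he.mul_eq_one, rightOp_one, one_smul]
    rfl

end Relative

/-! ### Induced modules -/

section Induced

variable {E F : Type u} [Ring E] [Algebra ℂ E] [Ring F] [Algebra ℂ F]
  (𝒜 : ZMod 2 → Submodule ℂ E) [GradedAlgebra 𝒜]
  (ℬ : ZMod 2 → Submodule ℂ F) [GradedAlgebra ℬ]
  (M : Type u) [AddCommGroup M] [Module Eᵐᵒᵖ M] [Module ℂ M] [IsScalarTower ℂ Eᵐᵒᵖ M]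

/-- Right multiplication by an element of `E`. -/
def actE : E →ₗ[ℂ] Module.End ℂ M :=
  (Algebra.lsmul ℂ ℂ M : Eᵐᵒᵖ →ₐ[ℂ] Module.End ℂ M).toLinearMap ∘ₗ
    (MulOpposite.opLinearEquiv ℂ).toLinearMap

/-- The action `(m ⊗ y) a = (-1) ^ (|y| |a|) m a ⊗ y` of `E` on the induced module `M ⊗ F`. -/
def inducedLeft : E →ₗ[ℂ] Module.End ℂ (M ⊗[ℂ] F) where
  toFun a := TensorProduct.map (actE M (GradedAlgebra.proj 𝒜 0 a)) LinearMap.id +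
    TensorProduct.map (actE M (GradedAlgebra.proj 𝒜 1 a)) (sgn ℬ).toLinearMap
  map_add' a b := by
    simp only [map_add, TensorProduct.map_add_left]; abel
  map_smul' c a := by
    simp only [map_smul, TensorProduct.map_smul_left, smul_add, RingHom.id_apply]

variable {M} in
theorem inducedLeft_of_mem_zero {a : E} (ha : a ∈ 𝒜 0) (m : M) (y : F) :
    inducedLeft 𝒜 ℬ M a (m ⊗ₜ y) = (MulOpposite.op a • m) ⊗ₜ y := by
  simp only [inducedLeft, LinearMap.coe_mk, AddHom.coe_mk, GradedAlgebra.proj_apply,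
    DirectSum.decompose_of_mem_same 𝒜 ha, DirectSum.decompose_of_mem_ne 𝒜 ha zero_ne_one, map_zero,
    TensorProduct.map_zero_left, add_zero, TensorProduct.map_tmul]
  rfl

variable {M} in
theorem inducedLeft_of_mem_one {a : E} (ha : a ∈ 𝒜 1) (m : M) (y : F) :
    inducedLeft 𝒜 ℬ M a (m ⊗ₜ y) = (MulOpposite.op a • m) ⊗ₜ sgn ℬ y := by
  simp only [inducedLeft, LinearMap.coe_mk, AddHom.coe_mk, GradedAlgebra.proj_apply,
    DirectSum.decompose_of_mem_same 𝒜 ha, DirectSum.decompose_of_mem_ne 𝒜 ha one_ne_zero, map_zero,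
    TensorProduct.map_zero_left, zero_add, TensorProduct.map_tmul]
  rfl

theorem inducedLeft_mul (a b : E) :
    inducedLeft 𝒜 ℬ M (a * b) = inducedLeft 𝒜 ℬ M b * inducedLeft 𝒜 ℬ M a := by
  refine TensorProduct.ext' fun m y => ?_
  obtain ⟨a, ha, a', ha', rfl⟩ := exists_eq_add_of_grading 𝒜 a
  obtain ⟨b, hb, b', hb', rfl⟩ := exists_eq_add_of_grading 𝒜 b
  simp only [mul_add, add_mul, map_add, LinearMap.add_apply, Module.End.mul_apply,
    inducedLeft_of_mem_zero 𝒜 ℬ ha, inducedLeft_of_mem_zero 𝒜 ℬ hb,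
    inducedLeft_of_mem_one 𝒜 ℬ ha', inducedLeft_of_mem_one 𝒜 ℬ hb',
    inducedLeft_of_mem_zero 𝒜 ℬ (mul_mem_grading 𝒜 0 ha hb (by decide)),
    inducedLeft_of_mem_zero 𝒜 ℬ (mul_mem_grading 𝒜 0 ha' hb' (by decide)),
    inducedLeft_of_mem_one 𝒜 ℬ (mul_mem_grading 𝒜 1 ha hb' (by decide)),
    inducedLeft_of_mem_one 𝒜 ℬ (mul_mem_grading 𝒜 1 ha' hb (by decide)),
    MulOpposite.op_mul, mul_smul, sgn_sgn]
  abel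

/-- The right action of `E` on the induced module. -/
def inducedLeftAlgHom : E →ₐ[ℂ] (Module.End ℂ (M ⊗[ℂ] F))ᵐᵒᵖ :=
  AlgHom.ofLinearMap ((MulOpposite.opLinearEquiv ℂ).toLinearMap ∘ₗ inducedLeft 𝒜 ℬ M)
    (congrArg MulOpposite.op (TensorProduct.ext' fun m y => by
      rw [inducedLeft_of_mem_zero 𝒜 ℬ SetLike.GradedOne.one_mem, MulOpposite.op_one, one_smul]
      rfl))
    (fun a b => congrArg MulOpposite.op (inducedLeft_mul 𝒜 ℬ M a b))

variable (F) in
/-- The right action of `F` on the induced module. -/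
def inducedRightAlgHom : F →ₐ[ℂ] (Module.End ℂ (M ⊗[ℂ] F))ᵐᵒᵖ :=
  AlgHom.ofLinearMap ((MulOpposite.opLinearEquiv ℂ).toLinearMap ∘ₗ
      LinearMap.lTensorHom M ∘ₗ (LinearMap.mul ℂ F).flip)
    (congrArg MulOpposite.op (TensorProduct.ext' fun m y => by simp))
    (fun a b => congrArg MulOpposite.op (TensorProduct.ext' fun m y => by simp [mul_assoc]))

/-- The sign rule under which the two actions define one of the twisted tensor product. -/
theorem induced_anticomm ⦃i j : ZMod 2⦄ (a : 𝒜 i) (b : ℬ j) :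
    inducedLeftAlgHom 𝒜 ℬ M a * inducedRightAlgHom F M b =
      (-1 : ℤˣ) ^ (j * i) • (inducedRightAlgHom F M b * inducedLeftAlgHom 𝒜 ℬ M a) := by
  obtain ⟨a, ha⟩ := a
  obtain ⟨b, hb⟩ := b
  have hl : inducedLeftAlgHom 𝒜 ℬ M a = MulOpposite.op (inducedLeft 𝒜 ℬ M a) := rfl
  have hr : inducedRightAlgHom F M b =
      MulOpposite.op (LinearMap.lTensor M (LinearMap.mulRight ℂ b)) := rfl
  dsimp only
  rw [hl, hr, ← MulOpposite.op_mul, ← MulOpposite.op_mul, ← MulOpposite.op_smul]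
  refine congrArg MulOpposite.op (TensorProduct.ext' fun m y => ?_)
  rw [Units.smul_def, LinearMap.smul_apply, ← Units.smul_def]
  rcases zmod_two_cases i with rfl | rfl
  · simp [inducedLeft_of_mem_zero 𝒜 ℬ ha]
  · rcases zmod_two_cases j with rfl | rfl
    · simp [inducedLeft_of_mem_one 𝒜 ℬ ha, sgn_of_mem_zero ℬ hb]
    · simp [inducedLeft_of_mem_one 𝒜 ℬ ha, sgn_of_mem_one ℬ hb, TensorProduct.tmul_neg]

/-- The right action of the twisted tensor product on the induced module. -/
def inducedHom : (𝒜 ᵍ⊗[ℂ] ℬ)ᵐᵒᵖ →+* Module.End ℂ (M ⊗[ℂ] F) where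
  toFun s := (GradedTensorProduct.lift 𝒜 ℬ (inducedLeftAlgHom 𝒜 ℬ M) (inducedRightAlgHom F M)
    (induced_anticomm 𝒜 ℬ M) s.unop).unop
  map_one' := by simp
  map_mul' s t := by simp
  map_zero' := by simp
  map_add' s t := by simp

/-- The induced module `M ⊗ F` over the twisted tensor product. -/
@[nolint unusedArguments]
def Induced (_𝒜 : ZMod 2 → Submodule ℂ E) (_ℬ : ZMod 2 → Submodule ℂ F) (M : Type u)
    [AddCommGroup M] [Module ℂ M] : Type u := M ⊗[ℂ] F

instance : AddCommGroup (Induced 𝒜 ℬ M) := inferInstanceAs (AddCommGroup (M ⊗[ℂ] F))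

instance : Module (𝒜 ᵍ⊗[ℂ] ℬ)ᵐᵒᵖ (Induced 𝒜 ℬ M) :=
  Module.compHom (M ⊗[ℂ] F) (inducedHom 𝒜 ℬ M)

theorem inducedHom_leftOp (a : E) :
    inducedHom 𝒜 ℬ M (leftOp 𝒜 ℬ (MulOpposite.op a)) = inducedLeft 𝒜 ℬ M a := by
  refine (congrArg MulOpposite.unop (GradedTensorProduct.lift_tmul 𝒜 ℬ _ _
    (induced_anticomm 𝒜 ℬ M) a 1)).trans ?_
  rw [map_one, mul_one]
  rfl

/-- A nonzero graded algebra has an even linear functional with value `1` at `1`. -/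
theorem exists_even_functional [Nontrivial F] :
    ∃ l : F →ₗ[ℂ] ℂ, l 1 = 1 ∧ ∀ y, l (sgn ℬ y) = l y := by
  obtain ⟨l, hl⟩ := Module.Projective.exists_dual_eq_one ℂ (one_ne_zero (α := F))
  refine ⟨(2⁻¹ : ℂ) • (l + l ∘ₗ (sgn ℬ).toLinearMap), ?_, fun y => ?_⟩
  · simp [hl]; norm_num
  · simp [add_comm]

/-- The map `m ↦ m ⊗ 1`, with the retraction given by an even functional on `F`, makes any
`E`-module a direct summand of its induced module. -/
theorem projDimLE_of_twist [Nontrivial F] (N : Type u) [AddCommGroup N] [Module Eᵐᵒᵖ N] {n : ℕ}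
    (h : ∀ (V : Type u) [AddCommGroup V] [Module (𝒜 ᵍ⊗[ℂ] ℬ)ᵐᵒᵖ V] [Module Eᵐᵒᵖ V],
      (∀ (r : Eᵐᵒᵖ) (x : V), r • x = leftOp 𝒜 ℬ r • x) → ProjDimLE Eᵐᵒᵖ V n) :
    ProjDimLE Eᵐᵒᵖ N n := by
  let _ : Module ℂ N := Module.compHom N (algebraMap ℂ Eᵐᵒᵖ)
  have : IsScalarTower ℂ Eᵐᵒᵖ N := IsScalarTower.of_algebraMap_smul fun _ _ => rfl
  obtain ⟨l, hl1, hl⟩ := exists_even_functional ℬ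
  let _ : Module Eᵐᵒᵖ (Induced 𝒜 ℬ N) := Module.compHom _ (leftOp 𝒜 ℬ)
  have hsmul (a : E) (z : Induced 𝒜 ℬ N) : MulOpposite.op a • z = inducedLeft 𝒜 ℬ N a z :=
    LinearMap.congr_fun (inducedHom_leftOp 𝒜 ℬ N a) z
  have hV : ProjDimLE Eᵐᵒᵖ (Induced 𝒜 ℬ N) n := h (Induced 𝒜 ℬ N) fun _ _ => rfl
  let i : N →ₗ[Eᵐᵒᵖ] Induced 𝒜 ℬ N :=
    { toFun := fun m => m ⊗ₜ[ℂ] (1 : F)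
      map_add' := fun x y => TensorProduct.add_tmul x y 1
      map_smul' := fun r m => by
        obtain ⟨a, rfl⟩ := MulOpposite.op_surjective r
        obtain ⟨b, hb, c, hc, rfl⟩ := exists_eq_add_of_grading 𝒜 a
        refine Eq.trans ?_ (hsmul (b + c) (m ⊗ₜ[ℂ] (1 : F))).symm
        rw [map_add, LinearMap.add_apply, inducedLeft_of_mem_zero 𝒜 ℬ hb,
          inducedLeft_of_mem_one 𝒜 ℬ hc, map_one, MulOpposite.op_add, add_smul,
          TensorProduct.add_tmul] }
  let q : N ⊗[ℂ] F →ₗ[ℂ] N := TensorProduct.rid ℂ N ∘ₗ TensorProduct.map LinearMap.id l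
  have hq (m : N) (y : F) : q (m ⊗ₜ y) = l y • m := rfl
  let p : Induced 𝒜 ℬ N →ₗ[Eᵐᵒᵖ] N :=
    { toFun := q
      map_add' := map_add q
      map_smul' := fun r z => by
        obtain ⟨a, rfl⟩ := MulOpposite.op_surjective r
        obtain ⟨b, hb, c, hc, rfl⟩ := exists_eq_add_of_grading 𝒜 a
        rw [RingHom.id_apply, hsmul]
        change N ⊗[ℂ] F at z
        induction z with
        | zero => simp only [map_zero, smul_zero]
        | add z w hz hw => simp only [map_add, smul_add] at hz hw ⊢; rw [hz, hw]
        | tmul m y =>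
          rw [map_add, LinearMap.add_apply, inducedLeft_of_mem_zero 𝒜 ℬ hb,
            inducedLeft_of_mem_one 𝒜 ℬ hc, map_add, hq, hq, hq, hl, ← smul_add, ← add_smul,
            ← MulOpposite.op_add, smul_comm] }
  refine hV.of_retract i p fun m => ?_
  change q (m ⊗ₜ 1) = m
  rw [hq, hl1, one_smul]

end Induced

/-! ### The global dimension of the twisted tensor product -/

theorem grGlobalDim_tensorGrading {E F : Type u} [Ring E] [Algebra ℂ E] [Ring F] [Algebra ℂ F]
    (𝒜 : ZMod 2 → Submodule ℂ E) [GradedAlgebra 𝒜]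
    (ℬ : ZMod 2 → Submodule ℂ F) [GradedAlgebra ℬ]
    [FiniteDimensional ℂ F] [Nontrivial F] [IsSemisimpleRing F] :
    grGlobalDim (tensorGrading 𝒜 ℬ) = grGlobalDim 𝒜 := by
  have hiff (V : Type u) [AddCommGroup V] [Module (𝒜 ᵍ⊗[ℂ] ℬ)ᵐᵒᵖ V] [Module Eᵐᵒᵖ V]
      (hV : ∀ (r : Eᵐᵒᵖ) (x : V), r • x = leftOp 𝒜 ℬ r • x) (n : ℕ) :
      ProjDimLE (𝒜 ᵍ⊗[ℂ] ℬ)ᵐᵒᵖ V n ↔ ProjDimLE Eᵐᵒᵖ V n :=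
    projDimLE_iff_of_projective_iff (leftOp 𝒜 ℬ) (projective_twist_iff 𝒜 ℬ) hV
  have key (n : ℕ) : grGlobalDim (tensorGrading 𝒜 ℬ) ≤ n ↔ grGlobalDim 𝒜 ≤ n := by
    rw [grGlobalDim_le_iff, grGlobalDim_le_iff]
    constructor
    · exact fun h N _ _ => projDimLE_of_twist 𝒜 ℬ N fun V _ _ _ hV => (hiff V hV n).1 (h V)
    · intro h V _ _
      let _ : Module Eᵐᵒᵖ V := Module.compHom V (leftOp 𝒜 ℬ)
      exact (hiff V (fun _ _ => rfl) n).2 (h V)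
  have hle {a b : ℕ∞} (h : ∀ n : ℕ, b ≤ n → a ≤ n) : a ≤ b := by
    induction b using ENat.recTopCoe with
    | top => exact le_top
    | coe b => exact h b le_rfl
  exact le_antisymm (hle fun n => (key n).2) (hle fun n => (key n).1)

end Z2Graded

end

theorem mainTheorem8 {E F : Type u} [Ring E] [Algebra ℂ E] [Ring F] [Algebra ℂ F]
    (𝒜 : ZMod 2 → Submodule ℂ E) [GradedAlgebra 𝒜]
    (ℬ : ZMod 2 → Submodule ℂ F) [GradedAlgebra ℬ]
    [FiniteDimensional ℂ F] [Nontrivial F] (hF : Z2Graded.IsGrSemisimple ℬ) :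
    Z2Graded.grGlobalDim (Z2Graded.tensorGrading 𝒜 ℬ) = Z2Graded.grGlobalDim 𝒜 ∧
      (Z2Graded.IsGrSemisimple (Z2Graded.tensorGrading 𝒜 ℬ) ↔ Z2Graded.IsGrSemisimple 𝒜) := by
  have : IsSemisimpleModule Fᵐᵒᵖ F := Z2Graded.isGrSemisimple_iff.1 hF
  have : IsSemisimpleRing Fᵐᵒᵖ := IsSemisimpleModule.congr (Z2Graded.opEquiv F).symm
  have : IsSemisimpleRing F := isSemisimpleRing_mulOpposite_iff.1 this
  have h := Z2Graded.grGlobalDim_tensorGrading 𝒜 ℬ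
  refine ⟨h, ?_⟩
  rw [Z2Graded.isGrSemisimple_iff_grGlobalDim_eq_zero,
    Z2Graded.isGrSemisimple_iff_grGlobalDim_eq_zero, h]
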